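/- Let $n\ge 3$, let $K\subset\mathbb R^{n-1}$ be compact, let $U\subset\mathbb R_x\times\mathbb R^{n-1}_y$ be an open neighbourhood of $\{0\}\times K$ and let $\delta_0>0$. For $(x,y)\in U$, $|\lambda|<\delta_0$, $\omega\in\mathbb S^{n-2}$ let $\gamma_{x,y,\lambda,\omega}:(-\delta_0,\delta_0)\to\mathbb R\times\mathbb R^{n-1}$ be curves depending smoothly on all parameters, with $$\gamma_{x,y,\lambda,\omega}(0)=(x,y),\qquad \gamma'_{x,y,\lambda,\omega}(0)=(\lambda,\omega),\qquad \gamma''_{x,y,\lambda,\omega}(t)=2\big(\alpha(x,y,\lambda,\omega,t),\beta(x,y,\lambda,\omega,t)\big),$$ where $\alpha,\beta$ are smooth and $\alpha\ge C$ for some constant $C>0$. Call $\chi=\chi(s,y,\omega)$ a cutoff if it is real-valued and smooth in $s\in\mathbb R$, in $y$ in a neighbourhood of $K$ and in $\omega\in\mathbb S^{n-2}$, with compact support in $s$, uniformly in $(y,\omega)$. For a cutoff $\chi$, $F>0$ and $x>0$ small put $$(Af)(x,y)=\int\int_{\mathbb S^{n-2}}\Big(\int_{-\delta_0}^{\delta_0}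 f(\gamma_{x,y,\lambda,\omega}(t))\,dt\Big)\,x^{-1}\chi(\lambda/x,y,\omega)\,d\omega\,d\lambda,\qquad A_F=x^{-1}e^{-F/x}Ae^{F/x}.$$ Let $X=(x'-x)/x^2$ and $Y=(y'-y)/x$. An integrable function $k(X,Y)$ is the front-face kernel of an operator $P$ at $y$ if the Schwartz kernel of $P$ at $(x,y)$, written with respect to $dX\,dY$, converges to $k$ as a distribution in $(X,Y)$ as $x\to0^+$, i.e. if for every $\varphi\in C_c^\infty(\mathbb R\times\mathbb R^{n-1})$, as $x\to0^+$, $$\Big(P\big[(x',y')\mapsto\varphi\big(\tfrac{x'-x}{x^2},\tfrac{y'-y}{x}\big)\big]\Big)(x,y)\to\int k\,\varphi\,dX\,dY .$$ The boundary principal symbol of $P$ (as a scattering operator of order $(-1,0)$) at $y$ is then the Fourier transform $\sigma(y,\xi,\eta)=\int e^{-i(\xi X+\eta\cdot Y)}k(X,Y)\,dX\,dY$. It is elliptic over $K$ if there is $c>0$ with $|\sigma(y,\xi,\eta)|\ge c\,(1+\xi^2+|\eta|^2)^{-1/2}$ for all $y\in K$, $\xi\in\mathbb R$, $\eta\in\mathbb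 R^{n-1}$. Let $F>0$. Then: (a) For every cutoff $\chi$ and every $y\in K$, the front-face kernel of $A_F$ at $y$ is the integrable function $$\tilde K(y,X,Y)=e^{-FX}|Y|^{-n+1}\Big\{\chi\Big(\tfrac{X-\alpha(0,y,0,\hat Y,0)|Y|^2}{|Y|},y,\hat Y\Big)+\chi\Big(\tfrac{-X+\alpha(0,y,0,-\hat Y,0)|Y|^2}{|Y|},y,-\hat Y\Big)\Big\},\qquad \hat Y=\tfrac{Y}{|Y|},$$ and hence the boundary principal symbol of $A_F$ at $y$ is the $(X,Y)$-Fourier transform of $\tilde K(y,\cdot,\cdot)$. (b) There is a cutoff $\chi$ with $\chi\ge0$ and $\chi(0,y,\omega)=1$ for all $y,\omega$ such that the boundary principal symbol of $A_F$ is elliptic over $K$. -/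

import Mathlib

open MeasureTheory Set Filter Topology
open scoped ContDiff

noncomputable section

namespace LocalXray

/-- The tangential variables `y ∈ ℝ^(n-1)`, with the Euclidean norm. -/
abbrev Tang (n : ℕ) : Type := EuclideanSpace ℝ (Fin (n - 1))

/-- The parameters `(x, y, l, θ, t)` with `(x, y) ∈ U`, `|l| < δ`, `θ` in the unit sphere of
`ℝ^(n-1)` and `|t| < δ`. Functions of `θ` are written as functions on `ℝ^(n-1)` of which only the
values on the unit sphere are used. -/
def paramDomain (n : ℕ) (U : Set (ℝ × Tang n)) (δ : ℝ) : Set (ℝ × Tang n × ℝ × Tang n × ℝ) :=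
  {p | (p.1, p.2.1) ∈ U ∧ |p.2.2.1| < δ ∧ p.2.2.2.1 ∈ Metric.sphere (0 : Tang n) 1 ∧
    |p.2.2.2.2| < δ}

/-- A smooth family of curves `t ↦ γ x y l θ t` in `ℝ × ℝ^(n-1)`, defined for `(x, y)` in a
neighbourhood `U` of `{0} × K` and `|l|, |t| < δ₀`, which starts at `(x, y)` with velocity `(l, θ)`
and has acceleration `2 (α, β)`, where `α` is bounded below by a positive constant.

Smoothness is `ContDiffOn` on a set of the form (open set) × sphere × (open interval); this is the
same as smoothness on that submanifold. -/
structure CurveFamily (n : ℕ) (K : Set (Tang n)) where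
  U : Set (ℝ × Tang n)
  isOpen_U : IsOpen U
  mem_U : ∀ y ∈ K, ((0 : ℝ), y) ∈ U
  δ₀ : ℝ
  δ₀_pos : 0 < δ₀
  γ : ℝ → Tang n → ℝ → Tang n → ℝ → ℝ × Tang n
  α : ℝ → Tang n → ℝ → Tang n → ℝ → ℝ
  β : ℝ → Tang n → ℝ → Tang n → ℝ → Tang n
  smooth_γ : ContDiffOn ℝ ∞
    (fun p : ℝ × Tang n × ℝ × Tang n × ℝ => γ p.1 p.2.1 p.2.2.1 p.2.2.2.1 p.2.2.2.2)
    (paramDomain n U δ₀)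
  smooth_α : ContDiffOn ℝ ∞
    (fun p : ℝ × Tang n × ℝ × Tang n × ℝ => α p.1 p.2.1 p.2.2.1 p.2.2.2.1 p.2.2.2.2)
    (paramDomain n U δ₀)
  smooth_β : ContDiffOn ℝ ∞
    (fun p : ℝ × Tang n × ℝ × Tang n × ℝ => β p.1 p.2.1 p.2.2.1 p.2.2.2.1 p.2.2.2.2)
    (paramDomain n U δ₀)
  position : ∀ x y l θ, (x, y) ∈ U → |l| < δ₀ → θ ∈ Metric.sphere (0 : Tang n) 1 →
    γ x y l θ 0 = (x, y)
  velocity : ∀ x y l θ, (x, y) ∈ U → |l| < δ₀ → θ ∈ Metric.sphere (0 : Tang n) 1 →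
    HasDerivAt (γ x y l θ) (l, θ) 0
  acceleration : ∀ x y l θ t, (x, y, l, θ, t) ∈ paramDomain n U δ₀ →
    iteratedDeriv 2 (γ x y l θ) t = (2 : ℝ) • (α x y l θ t, β x y l θ t)
  convex : ∃ C : ℝ, 0 < C ∧ ∀ x y l θ t, (x, y, l, θ, t) ∈ paramDomain n U δ₀ →
    C ≤ α x y l θ t

/-- `χ s y θ` is a smooth cutoff: it depends smoothly on `s ∈ ℝ`, on `y` in a neighbourhood of `K`
and on `θ` in the unit sphere, and its support in `s` is compact, uniformly in `y` and `θ`. -/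
def IsCutoff {n : ℕ} (K : Set (Tang n)) (χ : ℝ → Tang n → Tang n → ℝ) : Prop :=
  ∃ V : Set (Tang n), IsOpen V ∧ K ⊆ V ∧
    ContDiffOn ℝ ∞ (fun p : ℝ × Tang n × Tang n => χ p.1 p.2.1 p.2.2)
      (univ ×ˢ V ×ˢ Metric.sphere (0 : Tang n) 1) ∧
    ∃ R : ℝ, ∀ s : ℝ, ∀ y ∈ V, ∀ θ ∈ Metric.sphere (0 : Tang n) 1, R < |s| → χ s y θ = 0

/-- The ray transform `(I f)(x, y, l, θ)`: the integral of `f` along `γ x y l θ` on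
`(-δ₀, δ₀)`. -/
def rayTransform {n : ℕ} {K : Set (Tang n)} (𝒢 : CurveFamily n K) (f : ℝ × Tang n → ℂ)
    (x : ℝ) (y : Tang n) (l : ℝ) (θ : Tang n) : ℂ :=
  ∫ t in Ioo (-𝒢.δ₀) 𝒢.δ₀, f (𝒢.γ x y l θ t)

/-- The operator `(A f)(x, y) = ∫ ∫ (I f)(x, y, l, θ) x⁻¹ χ(l / x, y, θ) dθ dl`, with the surface
measure of the unit sphere in `θ`. For `χ` of compact support and small `x > 0` the restriction
to `|l| < δ₀` is automatic on the support of the integrand. -/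
def opA {n : ℕ} {K : Set (Tang n)} (𝒢 : CurveFamily n K) (χ : ℝ → Tang n → Tang n → ℝ)
    (f : ℝ × Tang n → ℂ) (z : ℝ × Tang n) : ℂ :=
  ∫ l in Ioo (-𝒢.δ₀) 𝒢.δ₀, ∫ θ : Metric.sphere (0 : Tang n) 1,
    rayTransform 𝒢 f z.1 z.2 l (θ : Tang n) *
      ((z.1⁻¹ * χ (l / z.1) z.2 (θ : Tang n) : ℝ) : ℂ) ∂((volume : Measure (Tang n)).toSphere)

/-- The conjugated operator `A_F = x⁻¹ e^(-F/x) A e^(F/x)`. -/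
def opAF {n : ℕ} {K : Set (Tang n)} (𝒢 : CurveFamily n K) (χ : ℝ → Tang n → Tang n → ℝ) (F : ℝ)
    (f : ℝ × Tang n → ℂ) (z : ℝ × Tang n) : ℂ :=
  ((z.1⁻¹ * Real.exp (-F / z.1) : ℝ) : ℂ) *
    opA 𝒢 χ (fun w => ((Real.exp (F / w.1) : ℝ) : ℂ) * f w) z

/-- The function `z' = (x', y') ↦ φ(X, Y)`, where `X = (x' - x) / x²` and `Y = (y' - y) / x` are
the scattering coordinates centred at `(x, y)`. -/
def scatteringPullback {n : ℕ} (φ : ℝ × Tang n → ℂ) (x : ℝ) (y : Tang n) : ℝ × Tang n → ℂ :=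
  fun w => φ ((w.1 - x) / x ^ 2, x⁻¹ • (w.2 - y))

/-- `k` is the restriction to the scattering front face, over the boundary point `y`, of the
Schwartz kernel of `P`. If `K_P(x, y, X, Y)` is the kernel with respect to `dX dY`, so that
`(P f)(x, y) = ∫ K_P(x, y, X, Y) f(x + x² X, y + x Y) dX dY`, this says that
`K_P(x, y, ·, ·)` tends to the integrable function `k` as a distribution in `(X, Y)` when
`x → 0+`. -/
def HasFrontFaceKernel {n : ℕ} (P : (ℝ × Tang n → ℂ) → ℝ × Tang n → ℂ) (y : Tang n)
    (k : ℝ × Tang n → ℂ) : Prop :=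
  Integrable k ∧ ∀ φ : ℝ × Tang n → ℂ, ContDiff ℝ ∞ φ → HasCompactSupport φ →
    Tendsto (fun x : ℝ => P (scatteringPullback φ x y) (x, y)) (𝓝[>] 0) (𝓝 (∫ w, k w * φ w))

/-- The Fourier transform in `(X, Y)`, with dual variables `(ξ, η)`. -/
def fourierXY {n : ℕ} (k : ℝ × Tang n → ℂ) (ξ : ℝ) (η : Tang n) : ℂ :=
  ∫ w : ℝ × Tang n, Complex.exp (-Complex.I * ((ξ * w.1 + inner ℝ η w.2 : ℝ) : ℂ)) * k w

/-- `σ` is the boundary principal symbol at `y` of the scattering operator `P` (of order `(-1, 0)`,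
so that its kernel on the front face is integrable): the Fourier transform in `(X, Y)` of the
restriction of the Schwartz kernel to the front face. -/
def HasBoundarySymbol {n : ℕ} (P : (ℝ × Tang n → ℂ) → ℝ × Tang n → ℂ) (y : Tang n)
    (σ : ℝ → Tang n → ℂ) : Prop :=
  ∃ k : ℝ × Tang n → ℂ, HasFrontFaceKernel P y k ∧ σ = fourierXY k

/-- The boundary principal symbol is unique. -/
theorem HasBoundarySymbol.unique {n : ℕ} {P : (ℝ × Tang n → ℂ) → ℝ × Tang n → ℂ} {y : Tang n}
    {σ τ : ℝ → Tang n → ℂ} (hσ : HasBoundarySymbol P y σ) (hτ : HasBoundarySymbol P y τ) :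
    σ = τ := by
  obtain ⟨k, ⟨hk, hk'⟩, rfl⟩ := hσ
  obtain ⟨m, ⟨hm, hm'⟩, rfl⟩ := hτ
  have h : k =ᵐ[volume] m := by
    refine ae_eq_of_integral_contDiff_smul_eq hk.locallyIntegrable hm.locallyIntegrable ?_
    intro g hg hgs
    have hc : ContDiff ℝ ∞ (fun w => ((g w : ℝ) : ℂ)) := Complex.ofRealCLM.contDiff.comp hg
    have hs : HasCompactSupport (fun w => ((g w : ℝ) : ℂ)) :=
      hgs.comp_left (g := fun r : ℝ => (r : ℂ)) Complex.ofReal_zero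
    have e := tendsto_nhds_unique (hk' _ hc hs) (hm' _ hc hs)
    simpa [Complex.real_smul, mul_comm] using e
  funext ξ η
  refine integral_congr_ae ?_
  filter_upwards [h] with w hw
  rw [hw]

/-- The Japanese bracket `⟨(ξ, η)⟩ = (1 + ξ² + |η|²)^(1/2)`. -/
def japanese {n : ℕ} (ξ : ℝ) (η : Tang n) : ℝ := Real.sqrt (1 + ξ ^ 2 + ‖η‖ ^ 2)

/-- The boundary principal symbol of `P`, as a scattering operator of order `(-1, 0)`, exists and
is elliptic over `K`: it is bounded below in absolute value by `c ⟨(ξ, η)⟩⁻¹` with `c > 0`,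
uniformly over `K`. -/
def IsBoundaryElliptic {n : ℕ} (K : Set (Tang n)) (P : (ℝ × Tang n → ℂ) → ℝ × Tang n → ℂ) :
    Prop :=
  ∃ σ : Tang n → ℝ → Tang n → ℂ, (∀ y ∈ K, HasBoundarySymbol P y (σ y)) ∧
    ∃ c : ℝ, 0 < c ∧ ∀ y ∈ K, ∀ (ξ : ℝ) (η : Tang n), c * (japanese ξ η)⁻¹ ≤ ‖σ y ξ η‖

/-- The explicit kernel
`e^(-F X) |Y|^(1-n) { χ((X - α(0,y,0,Ŷ,0) |Y|²) / |Y|, y, Ŷ)`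
`+ χ((-X + α(0,y,0,-Ŷ,0) |Y|²) / |Y|, y, -Ŷ) }`, where `Ŷ = Y / |Y|`. -/
def boundaryKernel {n : ℕ} {K : Set (Tang n)} (𝒢 : CurveFamily n K)
    (χ : ℝ → Tang n → Tang n → ℝ) (F : ℝ) (y : Tang n) (w : ℝ × Tang n) : ℂ :=
  let X : ℝ := w.1
  let r : ℝ := ‖w.2‖
  let Yhat : Tang n := ‖w.2‖⁻¹ • w.2
  ((Real.exp (-F * X) * r ^ (1 - (n : ℤ)) *
    (χ ((X - 𝒢.α 0 y 0 Yhat 0 * r ^ 2) / r) y Yhat +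
      χ ((-X + 𝒢.α 0 y 0 (-Yhat) 0 * r ^ 2) / r) y (-Yhat)) : ℝ) : ℂ)

end LocalXray

end

/-!
Rescale the curves through `(x, y)` by `l = x s` for the normal velocity and by `x t` for the time.
In the scattering coordinates they converge, as `x → 0`, to the parabolas
`X = s t + α(θ) t²`, `Y = t θ`, where `α(θ) = α(0, y, 0, θ, 0)`. Since `α` is bounded below by a
positive constant, a bound on `X` and `s` bounds `t`, so dominated convergence gives the limit of
the operator as an integral over `(s, θ, t)`. Polar coordinates `Y = t θ` followed by
`s ↦ X = s t + α(θ) t²` have Jacobian `|t|^(n-1)` and turn that integral into the one against the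
boundary kernel, whose two summands come from `t > 0` and from `t < 0`.

For the ellipticity take `χ = ψ(s √(F / α))`. Scaling `s` and `t` makes the symbol equal to
`F⁻¹ ∫ m_ψ(ξ / F, η · θ / √(α F)) dθ` with one model integral
`m_ψ(ξ, q) = ∫∫ exp (-(1 + i ξ) (s t + t²) - i q t) ψ(s) ds dt`. For `ψ(s) = exp (-s² / 2)` this is
`(2 π / ⟨ξ⟩) exp (-(q / ⟨ξ⟩)² / 2)`, and its integral over the sphere is bounded below by a multiple
of `(1 + ξ² + |η|²)^(-1/2)` because the Gaussian concentrates near the equator `η · θ = 0`.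
The compactly supported profile `exp (-s² / 2) κ(c s)` is a superposition of modulated Gaussians of
small frequency, so for small `c` its model integral differs from the Gaussian one by an error
`ε` times a wider Gaussian of the same amplitude, which is absorbed after integration over `θ`.
-/

noncomputable section

namespace LocalXray

open scoped RealInnerProductSpace

/-! ### Parabolic polar coordinates -/

/-- The unit sphere of a normed space, as a type. -/
abbrev UnitSphere (E : Type*) [NormedAddCommGroup E] : Type _ := Metric.sphere (0 : E) 1

section Polar

variable {E : Type*} [NormedAddCommGroup E] [NormedSpace ℝ E]

/-- Polar coordinates `(θ, r) ↦ r θ`. -/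
def polarMap (p : UnitSphere E × Ioi (0 : ℝ)) : E := (p.2 : ℝ) • (p.1 : E)

variable [MeasurableSpace E] [BorelSpace E]

theorem measurableEmbedding_polarMap : MeasurableEmbedding (polarMap (E := E)) :=
  (MeasurableEmbedding.subtype_coe (measurableSet_singleton (0 : E)).compl).comp
    (homeomorphUnitSphereProd E).symm.measurableEmbedding

theorem measurePreserving_polarMap [FiniteDimensional ℝ E] [Nontrivial E] (μ : Measure E)
    [μ.IsAddHaarMeasure] :
    MeasurePreserving polarMap
      (μ.toSphere.prod (Measure.volumeIoiPow (Module.finrank ℝ E - 1))) μ := by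
  have hval : MeasurePreserving ((↑) : ({0}ᶜ : Set E) → E) (μ.comap (↑)) μ := by
    refine ⟨measurable_subtype_coe, ?_⟩
    rw [map_comap_subtype_coe (measurableSet_singleton _).compl μ, restrict_compl_singleton]
  exact hval.comp (μ.measurePreserving_homeomorphUnitSphereProd.symm
    (homeomorphUnitSphereProd E).toMeasurableEquiv)

end Polar

section ParabolicPolar

/-- Lebesgue measure on the half-line `(0, ∞)`, as a type. -/
abbrev volumeIoi : Measure (Ioi (0 : ℝ)) := (volume : Measure ℝ).comap (↑)

instance : SigmaFinite volumeIoi := by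
  refine SigmaFinite.of_map volumeIoi measurable_subtype_coe.aemeasurable ?_
  rw [map_comap_subtype_coe measurableSet_Ioi]
  infer_instance

variable {E : Type*} [NormedAddCommGroup E]

/-- The map `(s, θ, t) ↦ (s t + a(θ) t², t θ)`: to second order, the point reached at time `t` on a
curve with initial velocity `(s, θ)` and acceleration `2 a(θ)` in the first variable. -/
def parabolicPolar [NormedSpace ℝ E] (a : UnitSphere E → ℝ) (p : ℝ × (UnitSphere E × ℝ)) : ℝ × E :=
  (p.1 * p.2.2 + a p.2.1 * p.2.2 ^ 2, p.2.2 • (p.2.1 : E))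

/-- The affine substitution `s ↦ s r + a(θ) r²` of the line, with parameters `θ` and `r > 0`. -/
def shearEquiv [MeasurableSpace E] (a : UnitSphere E → ℝ) (ha : Measurable a) :
    ℝ × (UnitSphere E × Ioi (0 : ℝ)) ≃ᵐ ℝ × (UnitSphere E × Ioi (0 : ℝ)) where
  toFun q := (q.1 * q.2.2 + a q.2.1 * (q.2.2 : ℝ) ^ 2, q.2)
  invFun q := ((q.1 - a q.2.1 * (q.2.2 : ℝ) ^ 2) / q.2.2, q.2)
  left_inv q := by
    have : (q.2.2 : ℝ) ≠ 0 := q.2.2.2.ne'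
    ext <;> simp [this]
  right_inv q := by
    have : (q.2.2 : ℝ) ≠ 0 := q.2.2.2.ne'
    ext <;> simp [this]
  measurable_toFun := by
    simp only [Equiv.coe_fn_mk]
    fun_prop
  measurable_invFun := by
    simp only [Equiv.coe_fn_symm_mk]
    fun_prop

variable [MeasurableSpace E] {a : UnitSphere E → ℝ}

theorem volume_preimage_shearEquiv (ha : Measurable a)
    (S : Set (ℝ × (UnitSphere E × Ioi (0 : ℝ)))) (p : UnitSphere E × Ioi (0 : ℝ)) :
    ENNReal.ofReal p.2 * volume ((fun s : ℝ => (s, p)) ⁻¹' (shearEquiv a ha ⁻¹' S)) =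
      volume ((fun s : ℝ => (s, p)) ⁻¹' S) := by
  have hp : (0 : ℝ) < p.2 := p.2.2
  have hcomp : (fun s : ℝ => (s, p)) ⁻¹' (shearEquiv a ha ⁻¹' S) =
      (fun s : ℝ => s * (p.2 : ℝ)) ⁻¹' ((fun s => s + a p.1 * (p.2 : ℝ) ^ 2) ⁻¹'
        ((fun s : ℝ => (s, p)) ⁻¹' S)) := rfl
  rw [hcomp, Real.volume_preimage_mul_right hp.ne', measure_preimage_add_right, ← mul_assoc,
    ← ENNReal.ofReal_mul hp.le, abs_of_pos (inv_pos.2 hp), mul_inv_cancel₀ hp.ne',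
    ENNReal.ofReal_one, one_mul]

theorem lintegral_prod_volumeIoiPow {α : Type*} [MeasurableSpace α] (ν : Measure α) [SFinite ν]
    (m : ℕ) {f : α × Ioi (0 : ℝ) → ENNReal} (hf : Measurable f) :
    ∫⁻ p, f p ∂(ν.prod (Measure.volumeIoiPow m)) =
      ∫⁻ p, ENNReal.ofReal ((p.2 : ℝ) ^ m) * f p ∂(ν.prod volumeIoi) := by
  rw [Measure.volumeIoiPow, prod_withDensity_right (by fun_prop),
    lintegral_withDensity_eq_lintegral_mul _ (by fun_prop) hf]
  rfl

theorem measurePreserving_shearEquiv (ha : Measurable a) (ν : Measure (UnitSphere E)) [SFinite ν]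
    (m : ℕ) :
    MeasurePreserving (shearEquiv a ha)
      ((volume : Measure ℝ).prod (ν.prod (Measure.volumeIoiPow (m + 1))))
      ((volume : Measure ℝ).prod (ν.prod (Measure.volumeIoiPow m))) := by
  refine ⟨(shearEquiv a ha).measurable, ?_⟩
  ext S hS
  have hS' := (shearEquiv a ha).measurable hS
  rw [Measure.map_apply (shearEquiv a ha).measurable hS, Measure.prod_apply_symm hS,
    Measure.prod_apply_symm hS',
    lintegral_prod_volumeIoiPow _ _ (measurable_measure_prodMk_right hS),
    lintegral_prod_volumeIoiPow _ _ (measurable_measure_prodMk_right hS')]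
  refine lintegral_congr fun p => ?_
  have hp : (0 : ℝ) < p.2 := p.2.2
  rw [← volume_preimage_shearEquiv ha S p, ← mul_assoc, pow_succ,
    ENNReal.ofReal_mul (by positivity)]

/-- The product of Lebesgue measure, a measure `ν` and Lebesgue measure, for integration over the
parameters `(s, θ, t)` of the rays. -/
abbrev rayMeasure {α : Type*} [MeasurableSpace α] (ν : Measure α) : Measure (ℝ × (α × ℝ)) :=
  (volume : Measure ℝ).prod (ν.prod volume)

/-- The inclusion of the half `t > 0` of the space of the variables `(s, θ, t)`. -/
def halfIncl {α : Type*} (q : ℝ × (α × Ioi (0 : ℝ))) : ℝ × (α × ℝ) := (q.1, (q.2.1, (q.2.2 : ℝ)))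

theorem measurableEmbedding_halfIncl {α : Type*} [MeasurableSpace α] :
    MeasurableEmbedding (halfIncl (α := α)) :=
  MeasurableEmbedding.id.prodMap (MeasurableEmbedding.id.prodMap
    (MeasurableEmbedding.subtype_coe measurableSet_Ioi))

theorem measurePreserving_halfIncl {α : Type*} [MeasurableSpace α] (ν : Measure α) [SFinite ν] :
    MeasurePreserving halfIncl ((volume : Measure ℝ).prod (ν.prod volumeIoi))
      ((rayMeasure ν).restrict {p | 0 < p.2.2}) := by
  have hset : {p : ℝ × (α × ℝ) | 0 < p.2.2} = univ ×ˢ (univ ×ˢ Ioi 0) := by ext; simp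
  rw [hset, ← Measure.prod_restrict, ← Measure.prod_restrict, Measure.restrict_univ,
    Measure.restrict_univ]
  exact (MeasurePreserving.id volume).prod
    ((MeasurePreserving.id ν).prod (measurePreserving_subtype_coe measurableSet_Ioi))

variable [NormedSpace ℝ E] [BorelSpace E]

theorem measurableEmbedding_parabolicPolar_halfIncl (ha : Measurable a) :
    MeasurableEmbedding (parabolicPolar a ∘ halfIncl) :=
  (MeasurableEmbedding.id.prodMap measurableEmbedding_polarMap).comp
    (shearEquiv a ha).measurableEmbedding

variable [FiniteDimensional ℝ E] [Nontrivial E] (μ : Measure E) [μ.IsAddHaarMeasure]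

theorem measurePreserving_parabolicPolar_halfIncl (ha : Measurable a) :
    MeasurePreserving (parabolicPolar a ∘ halfIncl)
      (((volume : Measure ℝ).prod (μ.toSphere.prod volumeIoi)).withDensity
        fun q => ENNReal.ofReal ((q.2.2 : ℝ) ^ Module.finrank ℝ E))
      ((volume : Measure ℝ).prod μ) := by
  have hshear := measurePreserving_shearEquiv ha μ.toSphere (Module.finrank ℝ E - 1)
  rw [Nat.sub_add_cancel Module.finrank_pos, Measure.volumeIoiPow,
    prod_withDensity_right (by fun_prop), prod_withDensity_right (by fun_prop)] at hshear
  exact ((MeasurePreserving.id volume).prod (measurePreserving_polarMap μ)).comp hshear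

variable {F : Type*} [NormedAddCommGroup F] [NormedSpace ℝ F]

theorem integrable_iff_integrableOn_parabolicPolar (ha : Measurable a) (f : ℝ × E → F) :
    Integrable f ((volume : Measure ℝ).prod μ) ↔
      IntegrableOn (fun p => |p.2.2| ^ Module.finrank ℝ E • f (parabolicPolar a p))
        {p | 0 < p.2.2} (rayMeasure μ.toSphere) := by
  rw [← (measurePreserving_parabolicPolar_halfIncl μ ha).integrable_comp_emb
      (measurableEmbedding_parabolicPolar_halfIncl ha),
    integrable_withDensity_iff_integrable_smul' (by fun_prop) (by simp), IntegrableOn,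
    ← (measurePreserving_halfIncl μ.toSphere).integrable_comp_emb measurableEmbedding_halfIncl]
  refine integrable_congr (.of_forall fun q => ?_)
  have hq : (0 : ℝ) < q.2.2 := q.2.2.2
  simp [halfIncl, ENNReal.toReal_ofReal (pow_nonneg hq.le _), abs_of_pos hq]

theorem integral_eq_setIntegral_parabolicPolar (ha : Measurable a) (f : ℝ × E → F) :
    ∫ w, f w ∂((volume : Measure ℝ).prod μ) =
      ∫ p in {p | 0 < p.2.2}, |p.2.2| ^ Module.finrank ℝ E • f (parabolicPolar a p)
        ∂(rayMeasure μ.toSphere) := by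
  rw [← (measurePreserving_parabolicPolar_halfIncl μ ha).integral_comp
      (measurableEmbedding_parabolicPolar_halfIncl ha),
    integral_withDensity_eq_integral_toReal_smul (by fun_prop) (by simp),
    ← (measurePreserving_halfIncl μ.toSphere).integral_comp measurableEmbedding_halfIncl]
  refine integral_congr_ae (.of_forall fun q => ?_)
  have hq : (0 : ℝ) < q.2.2 := q.2.2.2
  simp [halfIncl, ENNReal.toReal_ofReal (pow_nonneg hq.le _), abs_of_pos hq]

/-- The reflection `(s, θ, t) ↦ (-s, θ, -t)`. -/
def reflectEquiv (α : Type*) [MeasurableSpace α] : ℝ × (α × ℝ) ≃ᵐ ℝ × (α × ℝ) :=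
  (MeasurableEquiv.neg ℝ).prodCongr ((MeasurableEquiv.refl α).prodCongr (MeasurableEquiv.neg ℝ))

theorem measurePreserving_reflectEquiv {α : Type*} [MeasurableSpace α] (ν : Measure α)
    [SFinite ν] :
    MeasurePreserving (reflectEquiv α) (rayMeasure ν) (rayMeasure ν) :=
  (Measure.measurePreserving_neg volume).prod
    ((MeasurePreserving.id ν).prod (Measure.measurePreserving_neg volume))

theorem integral_eq_integral_pos_add_reflect {α : Type*} [MeasurableSpace α] (ν : Measure α)
    [SFinite ν] {G : ℝ × (α × ℝ) → F} (hG : Integrable G (rayMeasure ν)) :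
    ∫ p, G p ∂(rayMeasure ν) =
      (∫ p in {p | 0 < p.2.2}, G p ∂(rayMeasure ν)) +
        ∫ p in {p | 0 < p.2.2}, G (reflectEquiv α p) ∂(rayMeasure ν) := by
  have hpos : MeasurableSet {p : ℝ × (α × ℝ) | 0 < p.2.2} :=
    measurableSet_lt measurable_const (by fun_prop)
  have hne : ∀ᵐ p ∂(rayMeasure ν), p.2.2 ≠ 0 :=
    Measure.quasiMeasurePreserving_snd.ae
      (Measure.quasiMeasurePreserving_snd.ae (Measure.ae_ne volume 0))
  rw [← integral_add_compl hpos hG, ← (measurePreserving_reflectEquiv ν).setIntegral_preimage_emb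
    (reflectEquiv α).measurableEmbedding G {p | 0 < p.2.2}ᶜ]
  congr 1
  refine setIntegral_congr_set ?_
  filter_upwards [hne] with p hp
  refine propext ⟨fun h => lt_of_le_of_ne (neg_nonpos.1 (not_lt.1 h)) hp.symm, fun h => ?_⟩
  exact not_lt.2 (neg_nonpos.2 (le_of_lt h))

theorem integrable_add_and_integral_eq_of_parabolicPolar (ha : Measurable a)
    {G : ℝ × (UnitSphere E × ℝ) → F} (hG : Integrable G (rayMeasure μ.toSphere)) {f₁ f₂ : ℝ × E → F}
    (h₁ : ∀ p, 0 < p.2.2 → |p.2.2| ^ Module.finrank ℝ E • f₁ (parabolicPolar a p) = G p)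
    (h₂ : ∀ p, p.2.2 < 0 → |p.2.2| ^ Module.finrank ℝ E • f₂ (parabolicPolar a p) = G p) :
    Integrable (f₁ + f₂) ((volume : Measure ℝ).prod μ) ∧
      ∫ w, (f₁ + f₂) w ∂((volume : Measure ℝ).prod μ) = ∫ p, G p ∂(rayMeasure μ.toSphere) := by
  have hpos : MeasurableSet {p : ℝ × (UnitSphere E × ℝ) | 0 < p.2.2} :=
    measurableSet_lt measurable_const (by fun_prop)
  let negY : ℝ × E ≃ᵐ ℝ × E := (MeasurableEquiv.refl ℝ).prodCongr (MeasurableEquiv.neg E)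
  have hnegY : MeasurePreserving negY ((volume : Measure ℝ).prod μ)
      ((volume : Measure ℝ).prod μ) :=
    (MeasurePreserving.id volume).prod (Measure.measurePreserving_neg μ)
  have hreflect (p : ℝ × (UnitSphere E × ℝ)) :
      parabolicPolar a (reflectEquiv _ p) = negY (parabolicPolar a p) := by
    change ((-p.1) * (-p.2.2) + a p.2.1 * (-p.2.2) ^ 2, (-p.2.2) • (p.2.1 : E)) =
      (p.1 * p.2.2 + a p.2.1 * p.2.2 ^ 2, -(p.2.2 • (p.2.1 : E)))
    rw [neg_mul_neg, neg_sq, neg_smul]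
  have h₂' (p : ℝ × (UnitSphere E × ℝ)) (hp : 0 < p.2.2) :
      |p.2.2| ^ Module.finrank ℝ E • (f₂ ∘ negY) (parabolicPolar a p) =
        G (reflectEquiv _ p) := by
    rw [← h₂ (reflectEquiv _ p) (neg_lt_zero.2 hp), hreflect]
    exact congrArg (· ^ _ • f₂ (negY (parabolicPolar a p))) (abs_neg p.2.2).symm
  have hG' := ((measurePreserving_reflectEquiv μ.toSphere).integrable_comp_emb
    (reflectEquiv _).measurableEmbedding).2 hG
  have hf₁ : Integrable f₁ ((volume : Measure ℝ).prod μ) :=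
    (integrable_iff_integrableOn_parabolicPolar μ ha f₁).2
      (hG.integrableOn.congr_fun (fun p hp => (h₁ p hp).symm) hpos)
  have hf₂ : Integrable f₂ ((volume : Measure ℝ).prod μ) :=
    (hnegY.integrable_comp_emb negY.measurableEmbedding).1
      ((integrable_iff_integrableOn_parabolicPolar μ ha _).2
        (hG'.integrableOn.congr_fun (fun p hp => (h₂' p hp).symm) hpos))
  refine ⟨hf₁.add hf₂, ?_⟩
  rw [integral_add' hf₁ hf₂, ← hnegY.integral_comp negY.measurableEmbedding f₂,
    integral_eq_integral_pos_add_reflect _ hG]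
  exact congrArg₂ (· + ·)
    ((integral_eq_setIntegral_parabolicPolar μ ha f₁).trans (setIntegral_congr_fun hpos h₁))
    ((integral_eq_setIntegral_parabolicPolar μ ha _).trans (setIntegral_congr_fun hpos h₂'))

end ParabolicPolar

/-! ### Gaussian integrals over the sphere -/

section SphereGaussian

variable {E : Type*} [NormedAddCommGroup E] [InnerProductSpace ℝ E]

/-- The linear map which stretches the direction of the unit vector `e` by the factor `√(1 + B)`
and fixes its orthogonal complement. -/
def stretch (e : E) (B : ℝ) : E →ₗ[ℝ] E :=
  LinearMap.transvection (innerSL ℝ e : E →ₗ[ℝ] ℝ) ((√(1 + B) - 1) • e)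

theorem inner_stretch {e : E} (he : ‖e‖ = 1) (B : ℝ) (x : E) :
    ⟪e, stretch e B x⟫ = √(1 + B) * ⟪e, x⟫ := by
  simp only [stretch, LinearMap.transvection.apply, ContinuousLinearMap.coe_coe,
    innerSL_apply_apply, inner_add_right, inner_smul_right, real_inner_self_eq_norm_sq, he]
  ring

theorem norm_stretch_sq {e : E} (he : ‖e‖ = 1) {B : ℝ} (hB : 0 ≤ B) (x : E) :
    ‖stretch e B x‖ ^ 2 = ‖x‖ ^ 2 + B * ⟪e, x⟫ ^ 2 := by
  have hsq : √(1 + B) ^ 2 = 1 + B := Real.sq_sqrt (by positivity)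
  simp only [stretch, LinearMap.transvection.apply, ContinuousLinearMap.coe_coe,
    innerSL_apply_apply, smul_smul, norm_add_sq_real, norm_smul, he, mul_one, Real.norm_eq_abs,
    sq_abs, inner_smul_right, real_inner_comm e x]
  linear_combination ⟪e, x⟫ ^ 2 * hsq

/-- The complement of the open cylinder of radius one with axis `e`. -/
def outsideCylinder (e : E) : Set E := {x | 1 ≤ ‖x‖ ^ 2 - ⟪e, x⟫ ^ 2}

theorem mem_outsideCylinder {e x : E} :
    x ∈ outsideCylinder e ↔ 1 ≤ ‖x‖ ^ 2 - ⟪e, x⟫ ^ 2 := Iff.rfl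

theorem gaussian_polarMap (e : E) (B : ℝ) (p : UnitSphere E × Ioi (0 : ℝ)) :
    Real.exp (-‖polarMap p‖ ^ 2 - B * ⟪e, polarMap p⟫ ^ 2) =
      Real.exp (-(p.2 : ℝ) ^ 2 * (B * ⟪e, (p.1 : E)⟫ ^ 2) + -(p.2 : ℝ) ^ 2) := by
  congr 1
  simp only [polarMap, norm_smul, norm_eq_of_mem_sphere, inner_smul_right, Real.norm_eq_abs,
    mul_one, sq_abs]
  ring

variable [FiniteDimensional ℝ E]

theorem det_stretch {e : E} (he : ‖e‖ = 1) (B : ℝ) :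
    LinearMap.det (stretch e B) = √(1 + B) := by
  rw [stretch, LinearMap.transvection.det, ContinuousLinearMap.coe_coe, innerSL_apply_apply,
    inner_smul_right, real_inner_self_eq_norm_sq, he]
  ring

theorem exists_norm_eq_one_inner_eq_zero (hE : 2 ≤ Module.finrank ℝ E) (e : E) :
    ∃ v : E, ‖v‖ = 1 ∧ ⟪e, v⟫ = 0 := by
  have hspan : Module.finrank ℝ (Submodule.span ℝ {e}) ≤ 1 := by
    simpa using finrank_span_le_card (R := ℝ) ({e} : Set E)
  have hsum := Submodule.finrank_add_finrank_orthogonal (Submodule.span ℝ {e})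
  have : Nontrivial (Submodule.span ℝ {e})ᗮ :=
    Module.nontrivial_of_finrank_pos (R := ℝ) (by omega)
  obtain ⟨v, hv⟩ := exists_norm_eq (Submodule.span ℝ {e})ᗮ zero_le_one
  exact ⟨v, hv, Submodule.mem_orthogonal_singleton_iff_inner_right.1 v.2⟩

variable [MeasurableSpace E] [BorelSpace E]

theorem integral_comp_stretch {e : E} (he : ‖e‖ = 1) {B : ℝ} (hB : 0 ≤ B) {f : E → ℝ}
    (hf : StronglyMeasurable f) : ∫ x, f (stretch e B x) = (∫ x, f x) / √(1 + B) := by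
  have hdet : LinearMap.det (stretch e B) ≠ 0 := by
    rw [det_stretch he]
    positivity
  rw [← integral_map_of_stronglyMeasurable (stretch e B).continuous_of_finiteDimensional.measurable
      hf, Measure.map_linearMap_addHaar_eq_smul_addHaar volume hdet, integral_smul_measure,
    det_stretch he, abs_of_nonneg (by positivity), ENNReal.toReal_ofReal (by positivity),
    smul_eq_mul]
  ring

theorem integrable_exp_neg_norm_sq : Integrable fun x : E => Real.exp (-‖x‖ ^ 2) := by
  refine Integrable.of_integral_ne_zero ?_
  have h := GaussianFourier.integral_rexp_neg_mul_sq_norm (V := E) one_pos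
  simp only [neg_one_mul] at h
  rw [h]
  positivity

theorem measurableSet_outsideCylinder (e : E) : MeasurableSet (outsideCylinder e) :=
  measurableSet_le measurable_const (by fun_prop)

theorem setIntegral_outsideCylinder_gaussian {e : E} (he : ‖e‖ = 1) {B : ℝ} (hB : 0 ≤ B) :
    ∫ x in outsideCylinder e, Real.exp (-‖x‖ ^ 2 - B * ⟪e, x⟫ ^ 2) =
      (∫ x in outsideCylinder e, Real.exp (-‖x‖ ^ 2)) / √(1 + B) := by
  have hS := measurableSet_outsideCylinder e
  have hcyl : stretch e B ⁻¹' outsideCylinder e = outsideCylinder e := by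
    ext x
    rw [mem_preimage, mem_outsideCylinder, mem_outsideCylinder, norm_stretch_sq he hB,
      inner_stretch he, mul_pow, Real.sq_sqrt (add_nonneg zero_le_one hB)]
    ring_nf
  rw [← integral_indicator hS, ← integral_indicator hS, ← integral_comp_stretch he hB
    ((Measurable.stronglyMeasurable (by fun_prop)).indicator hS)]
  simp only [← indicator_comp_right (stretch e B), hcyl, Function.comp_def, norm_stretch_sq he hB,
    neg_add']

theorem integral_gaussian_stretch {e : E} (he : ‖e‖ = 1) {B : ℝ} (hB : 0 ≤ B) :
    ∫ x : E, Real.exp (-‖x‖ ^ 2 - B * ⟪e, x⟫ ^ 2) =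
      (∫ x : E, Real.exp (-‖x‖ ^ 2)) / √(1 + B) := by
  rw [← integral_comp_stretch he hB (Measurable.stronglyMeasurable (by fun_prop))]
  refine integral_congr_ae (.of_forall fun x => ?_)
  simp only [norm_stretch_sq he hB, neg_add']

theorem setIntegral_outsideCylinder_eq {e e' : E} (h : ‖e‖ = ‖e'‖) :
    ∫ x in outsideCylinder e, Real.exp (-‖x‖ ^ 2) =
      ∫ x in outsideCylinder e', Real.exp (-‖x‖ ^ 2) := by
  let ρ : E ≃ₗᵢ[ℝ] E := (Submodule.span ℝ {e - e'})ᗮ.reflection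
  have hρ : ρ e = e' := Submodule.reflection_sub h
  have hpre : ρ ⁻¹' outsideCylinder e' = outsideCylinder e := by
    ext x
    rw [mem_preimage, mem_outsideCylinder, mem_outsideCylinder, ρ.norm_map, ← hρ, ρ.inner_map_map]
  rw [← ρ.measurePreserving.setIntegral_preimage_emb ρ.toHomeomorph.measurableEmbedding _
    (outsideCylinder e'), hpre]
  simp only [ρ.norm_map]

theorem setIntegral_outsideCylinder_pos (hE : 2 ≤ Module.finrank ℝ E) (e : E) :
    0 < ∫ x in outsideCylinder e, Real.exp (-‖x‖ ^ 2) := by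
  have hopen : IsOpen {x : E | 1 < ‖x‖ ^ 2 - ⟪e, x⟫ ^ 2} :=
    isOpen_lt continuous_const (by fun_prop)
  obtain ⟨v, hv, hev⟩ := exists_norm_eq_one_inner_eq_zero hE e
  have hne : {x : E | 1 < ‖x‖ ^ 2 - ⟪e, x⟫ ^ 2}.Nonempty :=
    ⟨(2 : ℝ) • v, by norm_num [norm_smul, inner_smul_right, hv, hev]⟩
  have hvol : 0 < (volume : Measure E) (outsideCylinder e) :=
    (hopen.measure_pos volume hne).trans_le (measure_mono fun x hx =>
      mem_outsideCylinder.2 (le_of_lt hx))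
  have : NeZero ((volume : Measure E).restrict (outsideCylinder e)) :=
    ⟨fun h => hvol.ne' (Measure.restrict_eq_zero.1 h)⟩
  exact integral_exp_pos integrable_exp_neg_norm_sq.integrableOn

/-- The integral of `θ ↦ exp (-B ⟪e, θ⟫²)` over the unit sphere. -/
def sphereGaussian (e : E) (B : ℝ) : ℝ :=
  ∫ θ : UnitSphere E, Real.exp (-B * ⟪e, (θ : E)⟫ ^ 2) ∂(volume : Measure E).toSphere

variable [Nontrivial E]

theorem integrable_gaussian_polarMap {e : E} {B : ℝ} (hB : 0 ≤ B) :
    Integrable (fun p => Real.exp (-‖polarMap p‖ ^ 2 - B * ⟪e, polarMap p⟫ ^ 2))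
      ((volume : Measure E).toSphere.prod
        (Measure.volumeIoiPow (Module.finrank ℝ E - 1))) := by
  have hint : Integrable fun x : E => Real.exp (-‖x‖ ^ 2 - B * ⟪e, x⟫ ^ 2) := by
    refine integrable_exp_neg_norm_sq.mono' (Continuous.aestronglyMeasurable (by fun_prop))
      (.of_forall fun x => ?_)
    rw [Real.norm_of_nonneg (Real.exp_nonneg _), Real.exp_le_exp]
    exact sub_le_self _ (by positivity)
  exact ((measurePreserving_polarMap volume).integrable_comp_emb
    measurableEmbedding_polarMap).2 hint

theorem exists_sphereGaussian_le :
    ∃ C : ℝ, 0 < C ∧ ∀ (e : E) (B : ℝ), ‖e‖ = 1 → 0 ≤ B → sphereGaussian e B ≤ C / √(1 + B) := by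
  set ν := Measure.volumeIoiPow (Module.finrank ℝ E - 1)
  let w : Ioi (0 : ℝ) → ℝ := (Iio ⟨1, mem_Ioi.2 one_pos⟩).indicator fun _ => Real.exp (-1)
  have hw : 0 < ∫ r, w r ∂ν := by
    rw [integral_indicator measurableSet_Iio, setIntegral_const, smul_eq_mul, Measure.real,
      Measure.volumeIoiPow_apply_Iio, ENNReal.toReal_ofReal (by positivity)]
    positivity
  have hG : 0 < ∫ x : E, Real.exp (-‖x‖ ^ 2) := integral_exp_pos integrable_exp_neg_norm_sq
  refine ⟨(∫ x : E, Real.exp (-‖x‖ ^ 2)) / ∫ r, w r ∂ν, by positivity, fun e B he hB => ?_⟩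
  suffices sphereGaussian e B * (∫ r, w r ∂ν) ≤ (∫ x : E, Real.exp (-‖x‖ ^ 2)) / √(1 + B) by
    rwa [div_right_comm, le_div_iff₀ hw]
  rw [sphereGaussian, ← integral_gaussian_stretch he hB, ← integral_prod_mul,
    ← (measurePreserving_polarMap volume).integral_comp measurableEmbedding_polarMap]
  refine integral_mono_of_nonneg (.of_forall fun p => ?_) (integrable_gaussian_polarMap hB)
    (.of_forall fun p => ?_)
  · exact mul_nonneg (Real.exp_nonneg _) (indicator_nonneg (fun _ _ => Real.exp_nonneg _) _)
  · simp only [gaussian_polarMap, w, indicator]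
    split_ifs with hp
    · have hp1 : (p.2 : ℝ) ^ 2 ≤ 1 := pow_le_one₀ p.2.2.le (le_of_lt hp)
      have hBp : 0 ≤ B * ⟪e, (p.1 : E)⟫ ^ 2 := by positivity
      rw [← Real.exp_add, Real.exp_le_exp]
      nlinarith
    · rw [mul_zero]
      positivity

theorem exists_le_sphereGaussian (hE : 2 ≤ Module.finrank ℝ E) :
    ∃ c : ℝ, 0 < c ∧ ∀ (e : E) (B : ℝ), ‖e‖ = 1 → 0 ≤ B → c / √(1 + B) ≤ sphereGaussian e B := by
  set ν := Measure.volumeIoiPow (Module.finrank ℝ E - 1)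
  obtain ⟨e₀, he₀⟩ := exists_norm_eq E zero_le_one
  have hG := setIntegral_outsideCylinder_pos hE e₀
  set N : ℝ := ∫ r : Ioi (0 : ℝ), Real.exp (-(r : ℝ) ^ 2) ∂ν
  have : 0 ≤ N := integral_nonneg fun _ => Real.exp_nonneg _
  refine ⟨(∫ x in outsideCylinder e₀, Real.exp (-‖x‖ ^ 2)) / (N + 1), by positivity,
    fun e B he hB => ?_⟩
  have hA : 0 ≤ sphereGaussian e B := integral_nonneg fun _ => Real.exp_nonneg _
  suffices (∫ x in outsideCylinder e₀, Real.exp (-‖x‖ ^ 2)) / √(1 + B) ≤ sphereGaussian e B * N by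
    rw [div_right_comm, div_le_iff₀ (by positivity)]
    linarith
  have hint : Integrable (fun p : UnitSphere E × Ioi (0 : ℝ) =>
      Real.exp (-B * ⟪e, (p.1 : E)⟫ ^ 2) * Real.exp (-(p.2 : ℝ) ^ 2))
      ((volume : Measure E).toSphere.prod ν) := by
    refine (integrable_gaussian_polarMap (e := e) le_rfl).mono'
      (Continuous.aestronglyMeasurable (by fun_prop)) (.of_forall fun p => ?_)
    rw [Real.norm_of_nonneg (by positivity), gaussian_polarMap, ← Real.exp_add, Real.exp_le_exp]
    nlinarith [mul_nonneg hB (sq_nonneg ⟪e, (p.1 : E)⟫)]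
  rw [setIntegral_outsideCylinder_eq (he₀.trans he.symm),
    ← setIntegral_outsideCylinder_gaussian he hB, sphereGaussian, ← integral_prod_mul,
    ← integral_indicator (measurableSet_outsideCylinder e),
    ← (measurePreserving_polarMap volume).integral_comp measurableEmbedding_polarMap]
  refine integral_mono_of_nonneg
    (.of_forall fun p => indicator_nonneg (fun _ _ => Real.exp_nonneg _) _) hint
    (.of_forall fun p => ?_)
  simp only [indicator, mem_outsideCylinder, gaussian_polarMap]
  split_ifs with hp
  · have hp1 : 1 ≤ (p.2 : ℝ) ^ 2 := by
      refine hp.trans ((sub_le_self _ (sq_nonneg _)).trans (le_of_eq ?_))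
      rw [polarMap, norm_smul, norm_eq_of_mem_sphere, mul_one, Real.norm_eq_abs, sq_abs]
    rw [← Real.exp_add, Real.exp_le_exp]
    nlinarith [mul_nonneg hB (sq_nonneg ⟪e, (p.1 : E)⟫)]
  · positivity

end SphereGaussian

/-! ### The model symbol -/

section ModelSymbol

open Complex

theorem norm_cexp_sub_cexp_le {M : ℝ} {z w : ℂ} (hz : z.re ≤ M) (hw : w.re ≤ M) :
    ‖cexp z - cexp w‖ ≤ Real.exp M * ‖z - w‖ :=
  (convex_halfSpace_re_le M).norm_image_sub_le_of_norm_hasDerivWithin_le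
    (fun x _ => (hasDerivAt_exp x).hasDerivWithinAt)
    (fun x hx => (norm_exp x).trans_le (Real.exp_le_exp.2 hx)) hw hz

theorem abs_mul_exp_neg_sq_div_eight_le (u : ℝ) : |u| * Real.exp (-u ^ 2 / 8) ≤ 2 := by
  have h : |u| ≤ 2 * Real.exp (u ^ 2 / 8) := by
    nlinarith [Real.add_one_le_exp (u ^ 2 / 8), sq_nonneg (|u| - 2), sq_abs u]
  rwa [neg_div, Real.exp_neg, ← div_eq_mul_inv, div_le_iff₀ (Real.exp_pos _)]

/-- The Gaussian `exp (-(u + ζ p)² / 2 - p² / 2)`, a complex shift of `exp (-u² / 2)`. -/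
def shiftedGaussian (ζ : ℂ) (u p : ℝ) : ℂ := cexp (-(u + ζ * p) ^ 2 / 2 - p ^ 2 / 2)

theorem re_shiftedGaussian_exponent_le {ζ : ℂ} (hζ : ‖ζ‖ = 1) (u p : ℝ) :
    (-(u + ζ * p) ^ 2 / 2 - p ^ 2 / 2 : ℂ).re ≤ -u ^ 2 / 4 := by
  have hζ' : ζ.re ^ 2 + ζ.im ^ 2 = 1 := by
    rw [pow_two, pow_two, ← normSq_apply, ← Complex.sq_norm, hζ, one_pow]
  have hre : (-(u + ζ * p) ^ 2 / 2 - p ^ 2 / 2 : ℂ).re =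
      -((u + ζ.re * p) ^ 2 - (ζ.im * p) ^ 2) / 2 - p ^ 2 / 2 := by
    simp [pow_two, -neg_add_rev]
  rw [hre]
  nlinarith [sq_nonneg (u + 2 * ζ.re * p), congrArg (· * p ^ 2) hζ']

theorem norm_shiftedGaussian_sub_le {ζ : ℂ} (hζ : ‖ζ‖ = 1) (u p : ℝ) :
    ‖shiftedGaussian ζ u p - Real.exp (-u ^ 2 / 2)‖ ≤
      2 * (|p| + p ^ 2) * Real.exp (-u ^ 2 / 8) := by
  have hw : ((-u ^ 2 / 2 : ℝ) : ℂ).re ≤ -u ^ 2 / 4 := by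
    rw [ofReal_re]; linarith [sq_nonneg u]
  have hsub : ‖-(u + ζ * p) ^ 2 / 2 - p ^ 2 / 2 - ((-u ^ 2 / 2 : ℝ) : ℂ)‖ ≤
      |u| * |p| + p ^ 2 := by
    have : (-(u + ζ * p) ^ 2 / 2 - p ^ 2 / 2 - ((-u ^ 2 / 2 : ℝ) : ℂ)) =
        -(ζ * (u * p) + (ζ ^ 2 + 1) / 2 * p ^ 2) := by push_cast; ring
    rw [this, norm_neg]
    have h2 : ‖(ζ ^ 2 + 1) / 2‖ ≤ 1 := by
      rw [norm_div, norm_ofNat, div_le_one two_pos]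
      refine (norm_add_le _ _).trans_eq ?_
      rw [norm_pow, hζ, norm_one]
      norm_num
    refine (norm_add_le _ _).trans (add_le_add ?_ ?_)
    · simp [hζ]
    · rw [norm_mul, norm_pow, norm_real, Real.norm_eq_abs, sq_abs]
      exact mul_le_of_le_one_left (sq_nonneg p) h2
  have hexp : Real.exp (-u ^ 2 / 4) = Real.exp (-u ^ 2 / 8) * Real.exp (-u ^ 2 / 8) := by
    rw [← Real.exp_add]; congr 1; ring
  have hle : Real.exp (-u ^ 2 / 8) ≤ 1 := Real.exp_le_one_iff.2 (by linarith [sq_nonneg u])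
  rw [shiftedGaussian, ofReal_exp]
  calc _ ≤ Real.exp (-u ^ 2 / 4) * (|u| * |p| + p ^ 2) :=
        (norm_cexp_sub_cexp_le (re_shiftedGaussian_exponent_le hζ u p) hw).trans (by gcongr)
    _ = (|u| * Real.exp (-u ^ 2 / 8) * |p| + Real.exp (-u ^ 2 / 8) * p ^ 2) *
        Real.exp (-u ^ 2 / 8) := by rw [hexp]; ring
    _ ≤ (2 * |p| + 1 * p ^ 2) * Real.exp (-u ^ 2 / 8) := by
        gcongr
        exact abs_mul_exp_neg_sq_div_eight_le u
    _ ≤ _ := by gcongr; linarith [sq_nonneg p]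

/-- The phase `-(1 + i ξ) (s t + t²) - i q t`, at the point `(s, t)`. -/
def modelPhase (ξ q : ℝ) (x : ℝ × ℝ) : ℂ := -(1 + ξ * I) * (x.1 * x.2 + x.2 ^ 2) - q * x.2 * I

/-- The model oscillatory integral `∫∫ exp (-(1 + i ξ) (s t + t²) - i q t) ψ(s) ds dt`. -/
def modelSymbol (ψ : ℝ → ℝ) (ξ q : ℝ) : ℂ := ∫ x : ℝ × ℝ, cexp (modelPhase ξ q x) * ψ x.1

/-- The integrand of `modelSymbol` for the modulated Gaussian `exp (i p s - s² / 2)`. -/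
def modelGaussian (ξ q p : ℝ) (x : ℝ × ℝ) : ℂ :=
  cexp (modelPhase ξ q x + p * x.1 * I - x.1 ^ 2 / 2)

theorem continuous_modelGaussian {Z : Type*} [TopologicalSpace Z] {p : Z → ℝ} {x : Z → ℝ × ℝ}
    (hp : Continuous p) (hx : Continuous x) (ξ q : ℝ) :
    Continuous fun z => modelGaussian ξ q (p z) (x z) := by
  unfold modelGaussian modelPhase
  fun_prop

theorem norm_modelGaussian (ξ q p : ℝ) (x : ℝ × ℝ) :
    ‖modelGaussian ξ q p x‖ = Real.exp (-(x.1 * x.2 + x.2 ^ 2) - x.1 ^ 2 / 2) := by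
  rw [modelGaussian, modelPhase, norm_exp]
  congr 1
  simp [pow_two]

theorem integrable_norm_modelGaussian :
    Integrable fun x : ℝ × ℝ => Real.exp (-(x.1 * x.2 + x.2 ^ 2) - x.1 ^ 2 / 2) := by
  have h := (integrable_exp_neg_mul_sq (show (0 : ℝ) < 1 / 6 by norm_num)).mul_prod
    (integrable_exp_neg_mul_sq (show (0 : ℝ) < 1 / 4 by norm_num))
  refine h.mono' (Continuous.aestronglyMeasurable (by fun_prop)) (.of_forall fun x => ?_)
  rw [Real.norm_of_nonneg (Real.exp_pos _).le, ← Real.exp_add, Real.exp_le_exp]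
  nlinarith [sq_nonneg (2 * x.1 + 3 * x.2)]

theorem integrable_modelGaussian (ξ q p : ℝ) : Integrable (modelGaussian ξ q p) := by
  have hc : Continuous (modelGaussian ξ q p) :=
    continuous_modelGaussian continuous_const continuous_id ξ q
  refine (integrable_norm_iff hc.aestronglyMeasurable).1 ?_
  simpa only [norm_modelGaussian] using integrable_norm_modelGaussian

theorem integral_cexp_neg_quadratic {a : ℝ} (ha : 0 < a) (c d : ℂ) :
    ∫ x : ℝ, cexp (-a * x ^ 2 + c * x + d) = √(Real.pi / a) * cexp (d + c ^ 2 / (4 * a)) := by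
  rw [integral_cexp_quadratic (by simpa using ha), neg_neg, ← ofReal_div, Real.sqrt_eq_rpow,
    ofReal_cpow (by positivity), ← sub_neg_eq_add d, mul_neg, div_neg]
  push_cast
  rfl

theorem integral_modelGaussian_fst (ξ q p t : ℝ) :
    ∫ s : ℝ, modelGaussian ξ q p (s, t) = √(Real.pi / (1 / 2 : ℝ)) *
      cexp (-((1 + ξ ^ 2) / 2 : ℝ) * t ^ 2 + -I * (q + (1 + ξ * I) * p) * t + -p ^ 2 / 2) := by
  have h := integral_cexp_neg_quadratic (a := 1 / 2) (by norm_num) (p * I - (1 + ξ * I) * t)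
    (-(1 + ξ * I) * t ^ 2 - q * t * I)
  refine (integral_congr_ae (.of_forall fun s => ?_)).trans (h.trans ?_)
  · rw [modelGaussian, modelPhase]
    push_cast
    ring_nf
  · push_cast
    ring_nf
    simp only [I_sq]
    ring_nf

theorem integral_modelGaussian (ξ q p : ℝ) :
    ∫ x, modelGaussian ξ q p x = (2 * Real.pi / √(1 + ξ ^ 2) : ℝ) *
      shiftedGaussian ((1 + ξ * I) / (√(1 + ξ ^ 2) : ℝ)) (q / √(1 + ξ ^ 2)) p := by
  have hpos : 0 < 1 + ξ ^ 2 := by positivity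
  have hconst : √(Real.pi / (1 / 2 : ℝ)) * √(Real.pi / ((1 + ξ ^ 2) / 2)) =
      2 * Real.pi / √(1 + ξ ^ 2) := by
    have h : Real.pi / (1 / 2 : ℝ) * (Real.pi / ((1 + ξ ^ 2) / 2)) =
        (2 * Real.pi) ^ 2 / (1 + ξ ^ 2) := by field_simp
    rw [← Real.sqrt_mul (by positivity), h, Real.sqrt_div (by positivity),
      Real.sqrt_sq (by positivity)]
  rw [Measure.volume_eq_prod, integral_prod_symm _ (integrable_modelGaussian ξ q p)]
  simp only [integral_modelGaussian_fst]
  rw [integral_const_mul, integral_cexp_neg_quadratic (by positivity), ← mul_assoc, ← ofReal_mul,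
    hconst, shiftedGaussian]
  set r := √(1 + ξ ^ 2) with hr
  have hr2 : (r : ℂ) ^ 2 = 1 + (ξ : ℂ) ^ 2 := by
    rw [← ofReal_pow, hr, Real.sq_sqrt hpos.le]; push_cast; rfl
  have hr0 : (r : ℂ) ≠ 0 := ofReal_ne_zero.2 (Real.sqrt_pos.2 hpos).ne'
  congr 2
  push_cast
  rw [← hr2]
  field_simp
  linear_combination 4 * (q + (1 + ξ * I) * p) ^ 2 * I_sq

theorem norm_one_add_mul_I_div_sqrt (ξ : ℝ) : ‖(1 + ξ * I) / (√(1 + ξ ^ 2) : ℝ)‖ = 1 := by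
  have h : ‖(1 + ξ * I : ℂ)‖ = √(1 + ξ ^ 2) := by
    rw [norm_eq_sqrt_sq_add_sq]; simp
  rw [norm_div, h, norm_real, Real.norm_of_nonneg (Real.sqrt_nonneg _),
    div_self (by positivity)]

section Superposition

variable {κ : ℝ → ℝ} {m : ℝ → ℂ} {c : ℝ}

theorem modelSymbol_gaussian_mul_superposition (hm : Integrable m)
    (hκ : ∀ s : ℝ, (κ s : ℂ) = ∫ v : ℝ, m v * cexp ((c * v : ℝ) * s * I)) (ξ q : ℝ) :
    modelSymbol (fun s => Real.exp (-s ^ 2 / 2) * κ s) ξ q =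
      ∫ v : ℝ, m v * ∫ x, modelGaussian ξ q (c * v) x := by
  have hpt : ∀ x : ℝ × ℝ, cexp (modelPhase ξ q x) * ((Real.exp (-x.1 ^ 2 / 2) * κ x.1 : ℝ) : ℂ) =
      ∫ v : ℝ, m v * modelGaussian ξ q (c * v) x := by
    intro x
    rw [ofReal_mul, hκ, ← mul_assoc, ← integral_const_mul]
    refine integral_congr_ae (.of_forall fun v => ?_)
    simp only [modelGaussian]
    rw [ofReal_exp, ← exp_add, mul_left_comm, ← exp_add]
    push_cast
    ring_nf
  have hint : Integrable (Function.uncurry fun (x : ℝ × ℝ) v => m v * modelGaussian ξ q (c * v) x)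
      (volume.prod volume) := by
    have hc : Continuous fun z : (ℝ × ℝ) × ℝ => modelGaussian ξ q (c * z.2) z.1 :=
      continuous_modelGaussian (continuous_const.mul continuous_snd) continuous_fst ξ q
    refine (integrable_norm_modelGaussian.mul_prod hm.norm).mono'
      (hm.aestronglyMeasurable.comp_snd.mul hc.aestronglyMeasurable) (.of_forall fun z => ?_)
    rw [Function.uncurry, norm_mul, norm_modelGaussian, mul_comm]
  simp only [modelSymbol, hpt, ← integral_const_mul]
  exact integral_integral_swap hint

theorem norm_integral_mul_shiftedGaussian_sub_le {ζ : ℂ} (hζ : ‖ζ‖ = 1)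
    (hm : Integrable m) (hm1 : ∫ v, m v = 1) (hmom : ∀ k : ℕ, Integrable fun v => |v| ^ k * ‖m v‖)
    (u : ℝ) :
    ‖(∫ v, m v * shiftedGaussian ζ u (c * v)) - Real.exp (-u ^ 2 / 2)‖ ≤
      2 * (|c| * (∫ v, |v| ^ 1 * ‖m v‖) + c ^ 2 * ∫ v, |v| ^ 2 * ‖m v‖) *
        Real.exp (-u ^ 2 / 8) := by
  set g : ℝ → ℂ := fun v => shiftedGaussian ζ u (c * v) - Real.exp (-u ^ 2 / 2)
  set D : ℝ → ℝ := fun v =>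
    2 * (|c| * (|v| ^ 1 * ‖m v‖) + c ^ 2 * (|v| ^ 2 * ‖m v‖)) * Real.exp (-u ^ 2 / 8)
  have hD : Integrable D :=
    (((hmom 1).const_mul _).add ((hmom 2).const_mul _)).const_mul 2 |>.mul_const _
  have hle : ∀ v, ‖m v * g v‖ ≤ D v := fun v => calc
    _ ≤ ‖m v‖ * (2 * (|c * v| + (c * v) ^ 2) * Real.exp (-u ^ 2 / 8)) := by
        rw [norm_mul]
        gcongr
        exact norm_shiftedGaussian_sub_le hζ u _
    _ = D v := by simp only [D, abs_mul, sq_abs, mul_pow]; ring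
  have hg : Continuous g := by
    simp only [g, shiftedGaussian]
    fun_prop
  have hmg : Integrable fun v => m v * g v :=
    hD.mono' (hm.aestronglyMeasurable.mul hg.aestronglyMeasurable) (.of_forall hle)
  have hsplit : (∫ v, m v * shiftedGaussian ζ u (c * v)) - Real.exp (-u ^ 2 / 2) =
      ∫ v, m v * g v := by
    have h := integral_add hmg (hm.mul_const ((Real.exp (-u ^ 2 / 2) : ℝ) : ℂ))
    rw [integral_mul_const, hm1, one_mul] at h
    rw [sub_eq_iff_eq_add, ← h]
    exact integral_congr_ae (.of_forall fun v => by simp only [g]; ring)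
  rw [hsplit]
  refine (norm_integral_le_of_norm_le hD (.of_forall hle)).trans_eq ?_
  rw [integral_mul_const, integral_const_mul, integral_add ((hmom 1).const_mul _)
    ((hmom 2).const_mul _), integral_const_mul, integral_const_mul]

end Superposition

theorem exists_bump_eq_integral_exp :
    ∃ (κ : ℝ → ℝ) (m : ℝ → ℂ), ContDiff ℝ ∞ κ ∧ (∃ R, ∀ s, R < |s| → κ s = 0) ∧ (∀ s, 0 ≤ κ s) ∧
      κ 0 = 1 ∧ Integrable m ∧ (∀ k : ℕ, Integrable fun v => |v| ^ k * ‖m v‖) ∧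
      ∀ s : ℝ, (κ s : ℂ) = ∫ v : ℝ, m v * cexp (v * s * I) := by
  let b : ContDiffBump (0 : ℝ) := ⟨1, 2, one_pos, by norm_num⟩
  have hb : HasCompactSupport fun s => ((b s : ℝ) : ℂ) :=
    b.hasCompactSupport.comp_left (g := fun r : ℝ => (r : ℂ)) ofReal_zero
  let B := hb.toSchwartzMap (ofRealCLM.contDiff.comp b.contDiff : ContDiff ℝ ∞ _)
  refine ⟨fun s => b (s / (2 * Real.pi)), FourierTransform.fourier B,
    b.contDiff.comp (contDiff_id.div_const _), ⟨2 * (2 * Real.pi), fun s hs => ?_⟩,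
    fun s => b.nonneg, b.one_of_mem_closedBall (by simp [b.rIn_pos.le]), SchwartzMap.integrable _,
    SchwartzMap.integrable_pow_mul volume (FourierTransform.fourier B), fun s => ?_⟩
  · refine b.zero_of_le_dist ?_
    rw [dist_zero_right, norm_div, Real.norm_eq_abs, Real.norm_of_nonneg (by positivity),
      le_div_iff₀ (by positivity)]
    exact hs.le
  · have h : ((b (s / (2 * Real.pi)) : ℝ) : ℂ) = FourierTransformInv.fourierInv
        (FourierTransform.fourier B) (s / (2 * Real.pi)) := by
      rw [FourierTransform.fourierInv_fourier_eq]; rfl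
    rw [h, SchwartzMap.fourierInv_coe, Real.fourierInv_eq']
    refine integral_congr_ae (.of_forall fun v => ?_)
    have hv : 2 * Real.pi * inner ℝ v (s / (2 * Real.pi)) = v * s := by
      rw [Real.inner_apply]; field_simp
    simp only [hv, smul_eq_mul, ofReal_mul]
    exact mul_comm _ _

theorem exists_modelSymbol_approx {ε : ℝ} (hε : 0 < ε) :
    ∃ ψ : ℝ → ℝ, ContDiff ℝ ∞ ψ ∧ (∃ R, ∀ s, R < |s| → ψ s = 0) ∧ (∀ s, 0 ≤ ψ s) ∧ ψ 0 = 1 ∧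
      ∀ ξ q : ℝ, ‖modelSymbol ψ ξ q -
        (2 * Real.pi / √(1 + ξ ^ 2) * Real.exp (-(q / √(1 + ξ ^ 2)) ^ 2 / 2) : ℝ)‖ ≤
        2 * Real.pi / √(1 + ξ ^ 2) * (ε * Real.exp (-(q / √(1 + ξ ^ 2)) ^ 2 / 8)) := by
  obtain ⟨κ, m, hκ, ⟨R, hR⟩, hκ0, hκ1, hm, hmom, hκm⟩ := exists_bump_eq_integral_exp
  have hm1 : ∫ v, m v = 1 := by simpa [hκ1] using (hκm 0).symm
  obtain ⟨c, hc, hcε⟩ : ∃ c : ℝ, 0 < c ∧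
      2 * (|c| * (∫ v, |v| ^ 1 * ‖m v‖) + c ^ 2 * ∫ v, |v| ^ 2 * ‖m v‖) < ε := by
    have hcont : Continuous fun c : ℝ =>
        2 * (|c| * (∫ v, |v| ^ 1 * ‖m v‖) + c ^ 2 * ∫ v, |v| ^ 2 * ‖m v‖) := by fun_prop
    have hev := (hcont.tendsto 0).eventually_lt_const (by simpa using hε)
    exact ((eventually_mem_nhdsWithin (s := Ioi (0 : ℝ))).and
      (hev.filter_mono nhdsWithin_le_nhds)).exists
  have hκc : ∀ s : ℝ, (κ (c * s) : ℂ) = ∫ v : ℝ, m v * cexp ((c * v : ℝ) * s * I) := fun s => by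
    simp only [hκm, ofReal_mul, mul_left_comm, mul_assoc]
  refine ⟨fun s => Real.exp (-s ^ 2 / 2) * κ (c * s), ?_, ⟨R / c, fun s hs => ?_⟩,
    fun s => mul_nonneg (Real.exp_pos _).le (hκ0 _), by simp [hκ1], fun ξ q => ?_⟩
  · exact (by fun_prop : ContDiff ℝ ∞ fun s : ℝ => Real.exp (-s ^ 2 / 2)).mul
      (hκ.comp (contDiff_const.mul contDiff_id))
  · rw [div_lt_iff₀' hc] at hs
    have hκs : κ (c * s) = 0 := hR _ (by rwa [abs_mul, abs_of_pos hc])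
    simp only [hκs, mul_zero]
  · simp only [modelSymbol_gaussian_mul_superposition hm hκc, integral_modelGaussian,
      mul_left_comm (m _)]
    rw [integral_const_mul, ofReal_mul, ← mul_sub, norm_mul, norm_real,
      Real.norm_of_nonneg (by positivity)]
    gcongr
    refine (norm_integral_mul_shiftedGaussian_sub_le (norm_one_add_mul_I_div_sqrt ξ) hm hm1 hmom
      _).trans ?_
    gcongr

end ModelSymbol

/-! ### The boundary kernel in ray parameters -/

section Taylor

theorem exists_eq_add_mul_add_sq_mul_iteratedDeriv_two {g : ℝ → ℝ} {v t : ℝ}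
    (hg : ContDiffOn ℝ 2 g (uIcc 0 t)) (hv : HasDerivAt g v 0) :
    ∃ r ∈ uIcc 0 t, g t = g 0 + t * v + t ^ 2 * (iteratedDeriv 2 g r / 2) := by
  rcases eq_or_ne t 0 with rfl | ht
  · exact ⟨0, left_mem_uIcc, by simp⟩
  obtain ⟨r, hr, h⟩ := taylor_mean_remainder_lagrange_iteratedDeriv (n := 1) ht.symm hg
  rw [taylorWithinEval_succ, taylor_within_zero_eval, iteratedDerivWithin_one,
    hv.hasDerivWithinAt.derivWithin (uniqueDiffOn_uIcc ht.symm 0 left_mem_uIcc)] at h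
  norm_num at h
  exact ⟨r, uIoo_subset_uIcc_self hr, by linear_combination h⟩

theorem iteratedDeriv_clm_comp {E F : Type*} [NormedAddCommGroup E] [NormedSpace ℝ E]
    [NormedAddCommGroup F] [NormedSpace ℝ F] (L : E →L[ℝ] F) {c : ℝ → E} {r : ℝ} {i : ℕ}
    (hc : ContDiffAt ℝ i c r) : iteratedDeriv i (L ∘ c) r = L (iteratedDeriv i c r) :=
  congrArg (fun m => m fun _ => (1 : ℝ)) (L.iteratedFDeriv_comp_left hc le_rfl)

end Taylor

/-- The parameters `(s, θ, t)` of a ray: rescaled normal velocity, tangential direction and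
rescaled time. -/
abbrev RayParam (n : ℕ) : Type := ℝ × (UnitSphere (Tang n) × ℝ)

/-- The measure `ds dθ dt` on the space of ray parameters. -/
abbrev rayVolume (n : ℕ) : Measure (RayParam n) := rayMeasure (volume : Measure (Tang n)).toSphere

section Cutoff

variable {n : ℕ} {K : Set (Tang n)} {χ : ℝ → Tang n → Tang n → ℝ} {y : Tang n}

theorem IsCutoff.continuous_slice (hχ : IsCutoff K χ) (hy : y ∈ K) :
    Continuous fun p : ℝ × UnitSphere (Tang n) => χ p.1 y p.2 := by
  obtain ⟨V, -, hKV, hs, -⟩ := hχ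
  exact hs.continuousOn.comp_continuous
    (f := fun p : ℝ × UnitSphere (Tang n) => (p.1, y, (p.2 : Tang n)))
    (by fun_prop) fun p => ⟨mem_univ _, hKV hy, p.2.2⟩

theorem IsCutoff.continuous_rayParam (hχ : IsCutoff K χ) (hy : y ∈ K) :
    Continuous fun p : RayParam n => χ p.1 y p.2.1 :=
  (hχ.continuous_slice hy).comp (continuous_fst.prodMk (continuous_fst.comp continuous_snd))

theorem IsCutoff.exists_bound (hχ : IsCutoff K χ) (hy : y ∈ K) :
    ∃ R M : ℝ, (∀ s (θ : UnitSphere (Tang n)), R < |s| → χ s y θ = 0) ∧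
      ∀ s (θ : UnitSphere (Tang n)), |χ s y θ| ≤ M := by
  have hc := hχ.continuous_slice hy
  obtain ⟨V, -, hKV, -, R, hR⟩ := hχ
  obtain ⟨M, hM⟩ := ((isCompact_Icc (a := -R) (b := R)).prod
    (isCompact_univ (X := UnitSphere (Tang n)))).exists_bound_of_continuousOn hc.continuousOn
  refine ⟨R, max M 0, fun s θ h => hR s y (hKV hy) θ θ.2 h, fun s θ => ?_⟩
  by_cases h : R < |s|
  · simp [hR s y (hKV hy) θ θ.2 h]
  · exact (hM (s, θ) ⟨abs_le.1 (not_lt.1 h), mem_univ _⟩).trans (le_max_left _ _)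

end Cutoff

theorem half_mul_sq_sub_le_mul_add_mul_sq {C R a s : ℝ} (hC : 0 < C) (ha : C ≤ a) (hs : |s| ≤ R)
    (t : ℝ) : C / 2 * t ^ 2 - R ^ 2 / (2 * C) ≤ s * t + a * t ^ 2 := by
  have hsq : s * t + C * t ^ 2 = C / 2 * t ^ 2 - s ^ 2 / (2 * C) + (s + C * t) ^ 2 / (2 * C) := by
    field_simp
    ring
  have hsR : s ^ 2 / (2 * C) ≤ R ^ 2 / (2 * C) := by
    gcongr ?_ / _
    exact sq_le_sq' (abs_le.1 hs).1 (abs_le.1 hs).2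
  have : 0 ≤ (s + C * t) ^ 2 / (2 * C) := by positivity
  have : C * t ^ 2 ≤ a * t ^ 2 := by gcongr
  linarith

theorem integrable_indicator_mul_exp_neg_mul_sq {α : Type*} [MeasurableSpace α] (ν : Measure α)
    [IsFiniteMeasure ν] (R : ℝ) {b : ℝ} (hb : 0 < b) :
    Integrable (fun p : ℝ × (α × ℝ) => (Icc (-R) R).indicator 1 p.1 * Real.exp (-b * p.2.2 ^ 2))
      (rayMeasure ν) := by
  have hs : Integrable ((Icc (-R) R).indicator (1 : ℝ → ℝ)) :=
    (integrable_indicator_iff measurableSet_Icc).2 (integrableOn_const (by simp))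
  have ht : Integrable (fun q : α × ℝ => Real.exp (-b * q.2 ^ 2)) (ν.prod volume) := by
    simpa using (integrable_const (1 : ℝ)).mul_prod (integrable_exp_neg_mul_sq hb)
  exact hs.mul_prod ht

namespace CurveFamily

variable {n : ℕ} {K : Set (Tang n)} (𝒢 : CurveFamily n K) {y : Tang n}

theorem mem_paramDomain_zero (hy : ((0 : ℝ), y) ∈ 𝒢.U) (θ : UnitSphere (Tang n)) :
    ((0 : ℝ), y, (0 : ℝ), (θ : Tang n), (0 : ℝ)) ∈ paramDomain n 𝒢.U 𝒢.δ₀ :=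
  ⟨hy, by simpa using 𝒢.δ₀_pos, θ.2, by simpa using 𝒢.δ₀_pos⟩

theorem exists_taylor (L : ℝ × Tang n →L[ℝ] ℝ) {x : ℝ} {l : ℝ} {θ : Tang n} {t : ℝ}
    (h : (x, y, l, θ, t) ∈ paramDomain n 𝒢.U 𝒢.δ₀) :
    ∃ r : ℝ, |r| ≤ |t| ∧ L (𝒢.γ x y l θ t) =
      L (x, y) + t * L (l, θ) + t ^ 2 * L (𝒢.α x y l θ r, 𝒢.β x y l θ r) := by
  obtain ⟨hU, hl, hθ, ht⟩ := h
  have hsub : uIcc 0 t ⊆ Ioo (-𝒢.δ₀) 𝒢.δ₀ := fun r hr => abs_lt.1 (lt_of_le_of_lt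
    (by simpa using abs_sub_left_of_mem_uIcc hr) ht)
  have hγ : ContDiffOn ℝ 2 (𝒢.γ x y l θ) (Ioo (-𝒢.δ₀) 𝒢.δ₀) :=
    (𝒢.smooth_γ.comp (f := fun t : ℝ => (x, y, l, θ, t)) (by fun_prop)
      fun t ht => ⟨hU, hl, hθ, abs_lt.2 ht⟩).of_le (WithTop.coe_le_coe.2 le_top)
  obtain ⟨r, hr, h⟩ := exists_eq_add_mul_add_sq_mul_iteratedDeriv_two
    (L.contDiff.comp_contDiffOn (hγ.mono hsub))
    (L.hasFDerivAt.comp_hasDerivAt 0 (𝒢.velocity x y l θ hU hl hθ))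
  rw [iteratedDeriv_clm_comp L (hγ.contDiffAt (isOpen_Ioo.mem_nhds (hsub hr))),
    𝒢.acceleration x y l θ r ⟨hU, hl, hθ, abs_lt.2 (hsub hr)⟩, map_smul, smul_eq_mul] at h
  simp only [Function.comp_apply, 𝒢.position x y l θ hU hl hθ] at h
  exact ⟨r, by simpa using abs_sub_left_of_mem_uIcc hr, by linear_combination h⟩

/-- The coefficient `α(0, y, 0, θ, 0)` of the front face kernel at `y`. -/
def frontAccel (y : Tang n) (θ : UnitSphere (Tang n)) : ℝ := 𝒢.α 0 y 0 θ 0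

theorem continuous_frontAccel (hy : ((0 : ℝ), y) ∈ 𝒢.U) : Continuous (𝒢.frontAccel y) :=
  𝒢.smooth_α.continuousOn.comp_continuous
    (f := fun θ : UnitSphere (Tang n) => ((0 : ℝ), y, (0 : ℝ), (θ : Tang n), (0 : ℝ)))
    (by fun_prop) (𝒢.mem_paramDomain_zero hy)

theorem exists_le_frontAccel : ∃ C, 0 < C ∧ ∀ y ∈ K, ∀ θ, C ≤ 𝒢.frontAccel y θ := by
  obtain ⟨C, hC, hCα⟩ := 𝒢.convex
  exact ⟨C, hC, fun y hy θ => hCα _ _ _ _ _ (𝒢.mem_paramDomain_zero (𝒢.mem_U y hy) θ)⟩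

/-- The integrand `boundaryKernel * h` in the ray parameters `(s, θ, t)`, for which
`X = s t + α t²` and `Y = t θ`; both summands of the kernel become the same expression, on `t > 0`
and on `t < 0` respectively. -/
def pulledKernel (χ : ℝ → Tang n → Tang n → ℝ) (F : ℝ) (y : Tang n) (h : ℝ × Tang n → ℂ)
    (p : RayParam n) : ℂ :=
  ((Real.exp (-F * (parabolicPolar (𝒢.frontAccel y) p).1) * χ p.1 y p.2.1 : ℝ) : ℂ) *
    h (parabolicPolar (𝒢.frontAccel y) p)

variable {χ : ℝ → Tang n → Tang n → ℝ} {F : ℝ} {h : ℝ × Tang n → ℂ}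

theorem continuous_pulledKernel (hχ : IsCutoff K χ) (hy : y ∈ K) (hh : Continuous h) :
    Continuous (𝒢.pulledKernel χ F y h) := by
  have ha := 𝒢.continuous_frontAccel (𝒢.mem_U y hy)
  have hχ' := hχ.continuous_rayParam hy
  have hP : Continuous (parabolicPolar (𝒢.frontAccel y)) := by
    unfold parabolicPolar
    fun_prop
  exact (Complex.continuous_ofReal.comp
    ((Real.continuous_exp.comp (hP.fst.const_mul (-F))).mul hχ')).mul (hh.comp hP)

theorem norm_pulledKernel_le {C R M H : ℝ} (hF : 0 < F) (hC : 0 < C)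
    (hCa : ∀ θ, C ≤ 𝒢.frontAccel y θ)
    (hχR : ∀ s (θ : UnitSphere (Tang n)), R < |s| → χ s y θ = 0)
    (hχM : ∀ s (θ : UnitSphere (Tang n)), |χ s y θ| ≤ M) (hH : ∀ w, ‖h w‖ ≤ H) (p : RayParam n) :
    ‖𝒢.pulledKernel χ F y h p‖ ≤ Real.exp (F * (R ^ 2 / (2 * C))) * M * H *
      ((Icc (-R) R).indicator 1 p.1 * Real.exp (-(F * (C / 2)) * p.2.2 ^ 2)) := by
  rw [pulledKernel, norm_mul, Complex.norm_real, norm_mul, Real.norm_eq_abs, Real.norm_eq_abs,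
    Real.abs_exp]
  by_cases hs : R < |p.1|
  · have : p.1 ∉ Icc (-R) R := fun hmem => not_le.2 hs (abs_le.2 hmem)
    simp [hχR _ _ hs, indicator_of_notMem this]
  rw [indicator_of_mem (mem_Icc.2 (abs_le.1 (not_lt.1 hs))), Pi.one_apply, one_mul]
  have hexp : Real.exp (-F * (parabolicPolar (𝒢.frontAccel y) p).1) ≤
      Real.exp (F * (R ^ 2 / (2 * C))) * Real.exp (-(F * (C / 2)) * p.2.2 ^ 2) := by
    rw [← Real.exp_add]
    have hX : C / 2 * p.2.2 ^ 2 - R ^ 2 / (2 * C) ≤ (parabolicPolar (𝒢.frontAccel y) p).1 :=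
      half_mul_sq_sub_le_mul_add_mul_sq hC (hCa p.2.1) (not_lt.1 hs) p.2.2
    refine Real.exp_le_exp.2 ?_
    linear_combination F * hX
  have hM : 0 ≤ M := (abs_nonneg _).trans (hχM p.1 p.2.1)
  calc _ ≤ Real.exp (F * (R ^ 2 / (2 * C))) * Real.exp (-(F * (C / 2)) * p.2.2 ^ 2) * M * H := by
        gcongr
        · exact hχM _ _
        · exact hH _
    _ = _ := by ring

theorem integrable_pulledKernel (hχ : IsCutoff K χ) (hF : 0 < F) (hy : y ∈ K) (hh : Continuous h)
    {H : ℝ} (hH : ∀ w, ‖h w‖ ≤ H) : Integrable (𝒢.pulledKernel χ F y h) (rayVolume n) := by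
  obtain ⟨C, hC, hCa⟩ := 𝒢.exists_le_frontAccel
  obtain ⟨R, M, hχR, hχM⟩ := hχ.exists_bound hy
  exact ((integrable_indicator_mul_exp_neg_mul_sq _ R (by positivity)).const_mul _).mono'
    (𝒢.continuous_pulledKernel hχ hy hh).aestronglyMeasurable
    (.of_forall (𝒢.norm_pulledKernel_le hF hC (hCa y hy) hχR hχM hH))

/-- The summand of `boundaryKernel` containing the direction `σ Ŷ`, for `σ = ±1`. -/
def kernelSummand (χ : ℝ → Tang n → Tang n → ℝ) (F : ℝ) (y : Tang n) (σ : ℝ) (w : ℝ × Tang n) :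
    ℂ :=
  ((Real.exp (-F * w.1) * ‖w.2‖ ^ (1 - (n : ℤ)) *
    χ (σ * (w.1 - 𝒢.α 0 y 0 (σ • ‖w.2‖⁻¹ • w.2) 0 * ‖w.2‖ ^ 2) / ‖w.2‖) y
      (σ • ‖w.2‖⁻¹ • w.2) : ℝ) : ℂ)

theorem boundaryKernel_eq_kernelSummand_add_kernelSummand (w : ℝ × Tang n) :
    boundaryKernel 𝒢 χ F y w = 𝒢.kernelSummand χ F y 1 w + 𝒢.kernelSummand χ F y (-1) w := by
  simp only [boundaryKernel, kernelSummand, one_smul, neg_one_smul, one_mul, neg_one_mul, neg_sub',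
    sub_neg_eq_add]
  push_cast
  ring

theorem abs_pow_smul_kernelSummand_parabolicPolar (hn : 1 ≤ n) {σ : ℝ} {p : RayParam n}
    (hp : p.2.2 ≠ 0) (hσ : σ * p.2.2 = |p.2.2|) :
    |p.2.2| ^ (n - 1) • (𝒢.kernelSummand χ F y σ (parabolicPolar (𝒢.frontAccel y) p) *
      h (parabolicPolar (𝒢.frontAccel y) p)) = 𝒢.pulledKernel χ F y h p := by
  obtain ⟨s, θ, t⟩ := p
  have ht : |t| ≠ 0 := abs_ne_zero.2 hp
  have hdir : σ • |t|⁻¹ • t • (θ : Tang n) = θ := by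
    rw [smul_smul, smul_smul, mul_right_comm, hσ, mul_inv_cancel₀ ht, one_smul]
  have hslope (a : ℝ) : σ * (s * t + a * t ^ 2 - a * |t| ^ 2) / |t| = s := by
    rw [sq_abs, add_sub_cancel_right, mul_left_comm, hσ, mul_div_cancel_right₀ _ ht]
  have hpow : |t| ^ (n - 1) * |t| ^ (1 - (n : ℤ)) = 1 := by
    rw [← zpow_natCast, ← zpow_add₀ ht, show ((n - 1 : ℕ) : ℤ) + (1 - (n : ℤ)) = 0 by omega,
      zpow_zero]
  simp only [kernelSummand, pulledKernel, parabolicPolar, frontAccel, norm_smul, Real.norm_eq_abs,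
    norm_eq_of_mem_sphere, mul_one, hdir, hslope]
  rw [Complex.real_smul, ← mul_assoc, ← Complex.ofReal_mul]
  congr 2
  linear_combination Real.exp (-F * (s * t + 𝒢.α 0 y 0 θ 0 * t ^ 2)) * χ s y θ * hpow

theorem integrable_boundaryKernel_mul_and_integral_eq (hn : 2 ≤ n) (hχ : IsCutoff K χ) (hF : 0 < F)
    (hy : y ∈ K) (hh : Continuous h) {H : ℝ} (hH : ∀ w, ‖h w‖ ≤ H) :
    Integrable (fun w => boundaryKernel 𝒢 χ F y w * h w) ∧
      ∫ w, boundaryKernel 𝒢 χ F y w * h w = ∫ p, 𝒢.pulledKernel χ F y h p ∂(rayVolume n) := by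
  have hd : Module.finrank ℝ (Tang n) = n - 1 := by simp
  have : Nontrivial (Tang n) := Module.nontrivial_of_finrank_pos (R := ℝ) (by omega)
  have hsplit : (fun w => boundaryKernel 𝒢 χ F y w * h w) =
      (fun w => 𝒢.kernelSummand χ F y 1 w * h w) + fun w => 𝒢.kernelSummand χ F y (-1) w * h w :=
    funext fun w => by rw [𝒢.boundaryKernel_eq_kernelSummand_add_kernelSummand, add_mul]; rfl
  rw [hsplit]
  refine integrable_add_and_integral_eq_of_parabolicPolar volume
    (𝒢.continuous_frontAccel (𝒢.mem_U y hy)).measurable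
    (𝒢.integrable_pulledKernel hχ hF hy hh hH) (fun p hp => ?_) fun p hp => ?_ <;> rw [hd]
  · exact 𝒢.abs_pow_smul_kernelSummand_parabolicPolar (by omega) hp.ne'
      (by rw [one_mul, abs_of_pos hp])
  · exact 𝒢.abs_pow_smul_kernelSummand_parabolicPolar (by omega) hp.ne
      (by rw [neg_one_mul, abs_of_neg hp])

theorem integrable_boundaryKernel (hn : 2 ≤ n) (hχ : IsCutoff K χ) (hF : 0 < F) (hy : y ∈ K) :
    Integrable (boundaryKernel 𝒢 χ F y) := by
  simpa using (𝒢.integrable_boundaryKernel_mul_and_integral_eq hn hχ hF hy (h := fun _ => 1)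
    continuous_const (H := 1) (by simp)).1

end CurveFamily

/-! ### The limit of the rescaled operator -/

theorem setIntegral_Ioo_neg_eq_smul_integral {E : Type*} [NormedAddCommGroup E] [NormedSpace ℝ E]
    {x : ℝ} (hx : 0 < x) (δ : ℝ) (H : ℝ → E) :
    ∫ l in Ioo (-δ) δ, H l = x • ∫ s, (Ioo (-δ) δ).indicator H (x * s) := by
  rw [Measure.integral_comp_mul_left, abs_of_pos (inv_pos.2 hx), smul_smul,
    mul_inv_cancel₀ hx.ne', one_smul, integral_indicator measurableSet_Ioo]

theorem tendsto_id_nhdsGT_zero : Tendsto (fun x : ℝ => x) (𝓝[>] 0) (𝓝 0) := nhdsWithin_le_nhds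

theorem eventually_mul_mem_Ioo_neg {δ : ℝ} (hδ : 0 < δ) (c : ℝ) :
    ∀ᶠ x : ℝ in 𝓝[>] 0, x * c ∈ Ioo (-δ) δ := by
  have : Tendsto (fun x : ℝ => x * c) (𝓝[>] 0) (𝓝 0) := by
    simpa using tendsto_id_nhdsGT_zero.mul_const c
  exact this.eventually (Ioo_mem_nhds (neg_lt_zero.2 hδ) hδ)

theorem div_add_sq_mul_sub_div {x X : ℝ} (F : ℝ) (hx : x ≠ 0) (h : 1 + x * X ≠ 0) :
    F / (x + x ^ 2 * X) - F / x = -F * X / (1 + x * X) := by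
  rw [show x + x ^ 2 * X = x * (1 + x * X) by ring]
  field_simp
  ring

theorem div_add_sq_mul_sub_div_le {F x X Q : ℝ} (hF : 0 ≤ F) (hx : 0 < x) (hX : |X| ≤ Q)
    (hxQ : x * Q ≤ 1 / 2) : F / (x + x ^ 2 * X) - F / x ≤ 2 * F * Q := by
  have hden : 1 / 2 ≤ 1 + x * X := by
    have : x * -Q ≤ x * X := by gcongr; exact (abs_le.1 hX).1
    linarith
  rw [div_add_sq_mul_sub_div F hx.ne' (by linarith), div_le_iff₀ (by linarith)]
  have hFX : F * -X ≤ F * Q := by gcongr; exact neg_le.1 (abs_le.1 hX).1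
  have hFQ : 0 ≤ F * Q := mul_nonneg hF ((abs_nonneg X).trans hX)
  nlinarith

/-- The scattering coordinates `(X, Y)` centred at `(x, y)`. -/
def scatteringCoord {n : ℕ} (x : ℝ) (y : Tang n) (w : ℝ × Tang n) : ℝ × Tang n :=
  ((w.1 - x) / x ^ 2, x⁻¹ • (w.2 - y))

theorem fst_eq_add_sq_mul_scatteringCoord {n : ℕ} {x : ℝ} (hx : x ≠ 0) (y : Tang n)
    (w : ℝ × Tang n) : w.1 = x + x ^ 2 * (scatteringCoord x y w).1 := by
  rw [scatteringCoord]
  field_simp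
  ring

theorem integral_rayMeasure {α E : Type*} [MeasurableSpace α] [NormedAddCommGroup E]
    [NormedSpace ℝ E] {ν : Measure α} [SFinite ν] {G : ℝ × (α × ℝ) → E}
    (hG : Integrable G (rayMeasure ν)) :
    ∫ p, G p ∂(rayMeasure ν) = ∫ s : ℝ, ∫ a, (∫ t : ℝ, G (s, a, t)) ∂ν := by
  rw [integral_prod _ hG]
  refine integral_congr_ae ?_
  filter_upwards [hG.prod_right_ae] with s hs
  exact integral_prod _ hs

namespace CurveFamily

variable {n : ℕ} {K : Set (Tang n)} (𝒢 : CurveFamily n K) {x : ℝ} {y : Tang n}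

/-- The point of the curve with normal velocity `x s` and direction `θ` at time `x t`. In the
scattering coordinates it has a limit as `x → 0`. -/
def rescaledCurve (x : ℝ) (y : Tang n) (p : RayParam n) : ℝ × Tang n :=
  𝒢.γ x y (x * p.1) p.2.1 (x * p.2.2)

/-- The set of ray parameters for which `rescaledCurve` lies on one of the given curves. -/
def rescaledDomain (x : ℝ) : Set (RayParam n) :=
  {p | x * p.1 ∈ Ioo (-𝒢.δ₀) 𝒢.δ₀ ∧ x * p.2.2 ∈ Ioo (-𝒢.δ₀) 𝒢.δ₀}

theorem mem_paramDomain_of_mem_rescaledDomain (hU : (x, y) ∈ 𝒢.U) {p : RayParam n}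
    (hp : p ∈ 𝒢.rescaledDomain x) :
    (x, y, x * p.1, (p.2.1 : Tang n), x * p.2.2) ∈ paramDomain n 𝒢.U 𝒢.δ₀ :=
  ⟨hU, abs_lt.2 hp.1, p.2.1.2, abs_lt.2 hp.2⟩

theorem measurableSet_rescaledDomain (x : ℝ) : MeasurableSet (𝒢.rescaledDomain x) :=
  ((isOpen_Ioo.preimage (by fun_prop : Continuous fun p : RayParam n => x * p.1)).inter
    (isOpen_Ioo.preimage (by fun_prop : Continuous fun p : RayParam n => x * p.2.2))).measurableSet

theorem eventually_mem_U (hy : ((0 : ℝ), y) ∈ 𝒢.U) : ∀ᶠ x : ℝ in 𝓝[>] 0, (x, y) ∈ 𝒢.U :=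
  (tendsto_id_nhdsGT_zero.prodMk_nhds tendsto_const_nhds).eventually (𝒢.isOpen_U.mem_nhds hy)

theorem eventually_mem_rescaledDomain (p : RayParam n) :
    ∀ᶠ x : ℝ in 𝓝[>] 0, p ∈ 𝒢.rescaledDomain x :=
  (eventually_mul_mem_Ioo_neg 𝒢.δ₀_pos p.1).and (eventually_mul_mem_Ioo_neg 𝒢.δ₀_pos p.2.2)

theorem exists_taylor_fst_rescaledCurve (hx : x ≠ 0) (hU : (x, y) ∈ 𝒢.U) {p : RayParam n}
    (hp : p ∈ 𝒢.rescaledDomain x) : ∃ r, |r| < 𝒢.δ₀ ∧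
      (scatteringCoord x y (𝒢.rescaledCurve x y p)).1 =
        p.1 * p.2.2 + 𝒢.α x y (x * p.1) p.2.1 r * p.2.2 ^ 2 := by
  have hmem := 𝒢.mem_paramDomain_of_mem_rescaledDomain hU hp
  obtain ⟨r, hrt, hr⟩ := 𝒢.exists_taylor (ContinuousLinearMap.fst ℝ ℝ (Tang n)) hmem
  refine ⟨r, hrt.trans_lt hmem.2.2.2, ?_⟩
  simp only [ContinuousLinearMap.coe_fst'] at hr
  rw [scatteringCoord, rescaledCurve, hr]
  field_simp
  ring

theorem tendsto_taylor_remainder (L : ℝ × Tang n →L[ℝ] ℝ) (hy : ((0 : ℝ), y) ∈ 𝒢.U)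
    (p : RayParam n) :
    Tendsto (fun x : ℝ => (L (𝒢.rescaledCurve x y p) - L (x, y) -
        x * p.2.2 * L (x * p.1, (p.2.1 : Tang n))) / x ^ 2) (𝓝[>] 0)
      (𝓝 (p.2.2 ^ 2 * L (𝒢.α 0 y 0 p.2.1 0, 𝒢.β 0 y 0 p.2.1 0))) := by
  obtain ⟨s, θ, t⟩ := p
  have hev : ∀ᶠ x : ℝ in 𝓝[>] 0,
      (x, y, x * s, (θ : Tang n), x * t) ∈ paramDomain n 𝒢.U 𝒢.δ₀ := by
    filter_upwards [𝒢.eventually_mem_U hy, 𝒢.eventually_mem_rescaledDomain (s, θ, t)] with x hU hp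
    exact 𝒢.mem_paramDomain_of_mem_rescaledDomain hU hp
  choose! r hr hLr using fun (x : ℝ)
    (h : (x, y, x * s, (θ : Tang n), x * t) ∈ paramDomain n 𝒢.U 𝒢.δ₀) => 𝒢.exists_taylor L h
  have hmul (c : ℝ) : Tendsto (fun x : ℝ => x * c) (𝓝[>] 0) (𝓝 0) := by
    simpa using tendsto_id_nhdsGT_zero.mul_const c
  have hr0 : Tendsto r (𝓝[>] 0) (𝓝 0) :=
    squeeze_zero_norm' (hev.mono hr) (by simpa using (hmul t).abs)
  have hpt : Tendsto (fun x : ℝ => (x, y, x * s, (θ : Tang n), r x)) (𝓝[>] 0)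
      (𝓝[paramDomain n 𝒢.U 𝒢.δ₀] (0, y, 0, (θ : Tang n), 0)) :=
    tendsto_nhdsWithin_iff.2 ⟨tendsto_id_nhdsGT_zero.prodMk_nhds (tendsto_const_nhds.prodMk_nhds
        ((hmul s).prodMk_nhds (tendsto_const_nhds.prodMk_nhds hr0))),
      hev.mono fun x hx => ⟨hx.1, hx.2.1, hx.2.2.1, (hr x hx).trans_lt hx.2.2.2⟩⟩
  have hα := (𝒢.smooth_α.continuousOn _ (𝒢.mem_paramDomain_zero hy θ)).tendsto.comp hpt
  have hβ := (𝒢.smooth_β.continuousOn _ (𝒢.mem_paramDomain_zero hy θ)).tendsto.comp hpt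
  refine (((L.continuous.tendsto _).comp (hα.prodMk_nhds hβ)).const_mul (t ^ 2)).congr' ?_
  filter_upwards [hev, self_mem_nhdsWithin] with x hmem hx
  have hx : x ≠ 0 := ne_of_gt hx
  rw [rescaledCurve, hLr x hmem]
  simp only [Function.comp]
  field_simp
  ring

theorem tendsto_scatteringCoord_rescaledCurve (hy : ((0 : ℝ), y) ∈ 𝒢.U) (p : RayParam n) :
    Tendsto (fun x : ℝ => scatteringCoord x y (𝒢.rescaledCurve x y p)) (𝓝[>] 0)
      (𝓝 (parabolicPolar (𝒢.frontAccel y) p)) := by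
  refine Tendsto.prodMk_nhds ?_ ?_
  · have h := (𝒢.tendsto_taylor_remainder (ContinuousLinearMap.fst ℝ ℝ (Tang n)) hy p).const_add
      (p.1 * p.2.2)
    rw [ContinuousLinearMap.coe_fst', mul_comm (p.2.2 ^ 2)] at h
    refine h.congr' ?_
    filter_upwards [self_mem_nhdsWithin] with x hx
    have hx : x ≠ 0 := ne_of_gt hx
    field_simp
    ring
  · suffices hcoord : ∀ i, Tendsto (fun x : ℝ => (x⁻¹ • ((𝒢.rescaledCurve x y p).2 - y)) i) (𝓝[>] 0)
        (𝓝 ((p.2.2 • (p.2.1 : Tang n)) i)) from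
      ((PiLp.continuous_toLp 2 _).tendsto _).comp (tendsto_pi_nhds.2 hcoord)
    intro i
    let proj : ℝ × Tang n →L[ℝ] ℝ :=
      (EuclideanSpace.proj i).comp (ContinuousLinearMap.snd ℝ ℝ (Tang n))
    have hproj (v : ℝ × Tang n) : proj v = v.2 i := rfl
    have h := (tendsto_id_nhdsGT_zero.mul (𝒢.tendsto_taylor_remainder proj hy p)).const_add
      (p.2.2 * (p.2.1 : Tang n) i)
    rw [zero_mul, add_zero] at h
    refine h.congr' ?_
    filter_upwards [self_mem_nhdsWithin] with x hx
    have hx : x ≠ 0 := ne_of_gt hx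
    simp only [hproj, PiLp.smul_apply, PiLp.sub_apply, smul_eq_mul]
    field_simp
    ring

/-- The integrand of the conjugated operator in the ray parameters, `l = x s` and with time
`x t`. -/
def rescaledIntegrand (χ : ℝ → Tang n → Tang n → ℝ) (F : ℝ) (f : ℝ × Tang n → ℂ) (x : ℝ)
    (y : Tang n) : RayParam n → ℂ :=
  (𝒢.rescaledDomain x).indicator fun p =>
    (Real.exp (F / (𝒢.rescaledCurve x y p).1 - F / x) : ℝ) * f (𝒢.rescaledCurve x y p) *
      (χ p.1 y p.2.1 : ℝ)

theorem opAF_eq_integral_rescaledIntegrand (χ : ℝ → Tang n → Tang n → ℝ) (F : ℝ)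
    (f : ℝ × Tang n → ℂ) (hx : 0 < x) (y : Tang n) :
    opAF 𝒢 χ F f (x, y) = ∫ s : ℝ, ∫ θ : UnitSphere (Tang n),
      (∫ t : ℝ, 𝒢.rescaledIntegrand χ F f x y (s, θ, t))
        ∂((volume : Measure (Tang n)).toSphere) := by
  simp only [opAF, opA]
  rw [setIntegral_Ioo_neg_eq_smul_integral hx, Complex.real_smul, ← mul_assoc,
    ← integral_const_mul]
  congr 1 with s
  by_cases hs : x * s ∈ Ioo (-𝒢.δ₀) 𝒢.δ₀
  swap
  · have hzero (θ : UnitSphere (Tang n)) (t : ℝ) : 𝒢.rescaledIntegrand χ F f x y (s, θ, t) = 0 :=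
      indicator_of_notMem (fun h => hs h.1) _
    simp only [hzero, integral_zero, indicator_of_notMem hs, mul_zero]
  rw [indicator_of_mem hs, ← integral_const_mul]
  congr 1 with θ
  have hprefactor (I : ℂ) : ((x⁻¹ * Real.exp (-F / x) : ℝ) : ℂ) * x *
      (x * I * ((x⁻¹ * χ s y θ : ℝ) : ℂ)) = (Real.exp (-F / x) * χ s y θ : ℝ) * I := by
    have hxc : (x : ℂ) ≠ 0 := by exact_mod_cast hx.ne'
    push_cast
    field_simp
  rw [rayTransform, setIntegral_Ioo_neg_eq_smul_integral hx, Complex.real_smul,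
    mul_div_cancel_left₀ _ hx.ne', hprefactor, ← integral_const_mul]
  congr 1 with t
  by_cases ht : x * t ∈ Ioo (-𝒢.δ₀) 𝒢.δ₀
  · rw [rescaledIntegrand, indicator_of_mem ht,
      indicator_of_mem (show (s, θ, t) ∈ 𝒢.rescaledDomain x from ⟨hs, ht⟩), rescaledCurve,
      sub_eq_add_neg, Real.exp_add, neg_div]
    push_cast
    ring
  · rw [rescaledIntegrand, indicator_of_notMem ht, mul_zero,
      indicator_of_notMem fun h : (s, θ, t) ∈ 𝒢.rescaledDomain x => ht h.2]

variable {χ : ℝ → Tang n → Tang n → ℝ} {F : ℝ}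

theorem aestronglyMeasurable_rescaledIntegrand (hχ : IsCutoff K χ) (hy : y ∈ K) (F : ℝ)
    {f : ℝ × Tang n → ℂ} (hf : Measurable f) (hU : (x, y) ∈ 𝒢.U) :
    AEStronglyMeasurable (𝒢.rescaledIntegrand χ F f x y) (rayVolume n) := by
  have hD := 𝒢.measurableSet_rescaledDomain x
  rw [rescaledIntegrand, aestronglyMeasurable_indicator_iff hD]
  have hcurve : ContinuousOn (𝒢.rescaledCurve x y) (𝒢.rescaledDomain x) :=
    𝒢.smooth_γ.continuousOn.comp
      (f := fun p : RayParam n => (x, y, x * p.1, (p.2.1 : Tang n), x * p.2.2))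
      (by fun_prop) fun p hp => 𝒢.mem_paramDomain_of_mem_rescaledDomain hU hp
  have hweight : Measurable fun w : ℝ × Tang n =>
      ((Real.exp (F / w.1 - F / x) : ℝ) : ℂ) * f w := by
    fun_prop
  exact ((hweight.comp_aemeasurable (hcurve.aemeasurable (μ := rayVolume n) hD)).mul
    (Complex.continuous_ofReal.comp
      (hχ.continuous_rayParam hy)).measurable.aemeasurable).aestronglyMeasurable

variable {φ : ℝ × Tang n → ℂ}

theorem tendsto_rescaledIntegrand (F : ℝ) (hy : ((0 : ℝ), y) ∈ 𝒢.U) (hφ : Continuous φ)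
    (p : RayParam n) :
    Tendsto (fun x => 𝒢.rescaledIntegrand χ F (scatteringPullback φ x y) x y p) (𝓝[>] 0)
      (𝓝 (𝒢.pulledKernel χ F y φ p)) := by
  have hcoord := 𝒢.tendsto_scatteringCoord_rescaledCurve hy p
  have hden : Tendsto (fun x : ℝ => 1 + x * (scatteringCoord x y (𝒢.rescaledCurve x y p)).1)
      (𝓝[>] 0) (𝓝 1) := by
    simpa using (tendsto_id_nhdsGT_zero.mul hcoord.fst_nhds).const_add 1
  have hexp : Tendsto (fun x : ℝ => F / (𝒢.rescaledCurve x y p).1 - F / x) (𝓝[>] 0)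
      (𝓝 (-F * (parabolicPolar (𝒢.frontAccel y) p).1)) := by
    have h := (hcoord.fst_nhds.const_mul (-F)).div hden one_ne_zero
    rw [div_one] at h
    refine h.congr' ?_
    filter_upwards [self_mem_nhdsWithin, hden.eventually_ne one_ne_zero] with x hx hne
    rw [fst_eq_add_sq_mul_scatteringCoord (ne_of_gt hx) y (𝒢.rescaledCurve x y p)]
    exact (div_add_sq_mul_sub_div F (ne_of_gt hx) hne).symm
  have hmain := ((Complex.continuous_ofReal.tendsto _).comp
    (((Real.continuous_exp.tendsto _).comp hexp).mul_const (χ p.1 y p.2.1))).mul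
    ((hφ.tendsto _).comp hcoord)
  refine hmain.congr' ?_
  filter_upwards [𝒢.eventually_mem_rescaledDomain p] with x hp
  rw [rescaledIntegrand, indicator_of_mem hp]
  simp only [Function.comp, scatteringPullback, scatteringCoord]
  push_cast
  ring

theorem abs_le_sqrt_of_scatteringCoord_rescaledCurve_le {C R Q : ℝ} (hC : 0 < C)
    (hCα : ∀ x y l θ t, (x, y, l, θ, t) ∈ paramDomain n 𝒢.U 𝒢.δ₀ → C ≤ 𝒢.α x y l θ t)
    (hx : x ≠ 0) (hU : (x, y) ∈ 𝒢.U) {p : RayParam n} (hp : p ∈ 𝒢.rescaledDomain x)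
    (hs : |p.1| ≤ R) (hX : (scatteringCoord x y (𝒢.rescaledCurve x y p)).1 ≤ Q) :
    |p.2.2| ≤ √((Q + R ^ 2 / (2 * C)) / (C / 2)) := by
  obtain ⟨r, hr, htaylor⟩ := 𝒢.exists_taylor_fst_rescaledCurve hx hU hp
  have hα := hCα _ _ _ _ _ ⟨hU, abs_lt.2 hp.1, p.2.1.2, hr⟩
  refine Real.abs_le_sqrt ((le_div_iff₀ (by positivity)).2 ?_)
  linarith [half_mul_sq_sub_le_mul_add_mul_sq hC hα hs p.2.2]

/-- On the support of the integrand, `X` and `s` are bounded, hence so is `t`, because `X` grows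
quadratically in `t`. -/
theorem exists_norm_rescaledIntegrand_le (hχ : IsCutoff K χ) (hF : 0 ≤ F) (hy : y ∈ K)
    (hφ : Continuous φ) (hφs : HasCompactSupport φ) :
    ∃ R T B : ℝ, ∀ᶠ x : ℝ in 𝓝[>] 0, ∀ p : RayParam n,
      ‖𝒢.rescaledIntegrand χ F (scatteringPullback φ x y) x y p‖ ≤
        (Icc (-R) R ×ˢ (univ ×ˢ Icc (-T) T)).indicator (fun _ => B) p := by
  obtain ⟨C, hC, hCα⟩ := 𝒢.convex
  obtain ⟨R, M, hχR, hχM⟩ := hχ.exists_bound hy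
  obtain ⟨H, hH⟩ := hφ.bounded_above_of_compact_support hφs
  obtain ⟨Q, hQ⟩ := hφs.isCompact.isBounded.exists_norm_le
  refine ⟨R, √((Q + R ^ 2 / (2 * C)) / (C / 2)), Real.exp (2 * F * Q) * H * M, ?_⟩
  have hxQ : ∀ᶠ x : ℝ in 𝓝[>] 0, x * Q ∈ Ioo (-(1 / 2)) (1 / 2) :=
    eventually_mul_mem_Ioo_neg (by norm_num) Q
  filter_upwards [𝒢.eventually_mem_U (𝒢.mem_U y hy), hxQ, self_mem_nhdsWithin]
    with x hU hxQ (hx : 0 < x) p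
  have hH0 : 0 ≤ H := (norm_nonneg _).trans (hH 0)
  have hM0 : 0 ≤ M := (abs_nonneg _).trans (hχM p.1 p.2.1)
  by_cases hz : 𝒢.rescaledIntegrand χ F (scatteringPullback φ x y) x y p = 0
  · rw [hz, norm_zero]
    exact indicator_nonneg (fun _ _ => by positivity) _
  have hD : p ∈ 𝒢.rescaledDomain x := mem_of_indicator_ne_zero hz
  rw [rescaledIntegrand, indicator_of_mem hD] at hz ⊢
  set X := (scatteringCoord x y (𝒢.rescaledCurve x y p)).1
  have hX : |X| ≤ Q := (norm_fst_le _).trans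
    (hQ _ (subset_tsupport φ (right_ne_zero_of_mul (left_ne_zero_of_mul hz))))
  have hs : |p.1| ≤ R := not_lt.1 fun h => hz (by rw [hχR _ _ h, Complex.ofReal_zero, mul_zero])
  have ht := 𝒢.abs_le_sqrt_of_scatteringCoord_rescaledCurve_le hC hCα hx.ne' hU hD hs
    ((le_abs_self X).trans hX)
  rw [indicator_of_mem (show p ∈ _ ×ˢ (_ ×ˢ _) from ⟨abs_le.1 hs, mem_univ _, abs_le.1 ht⟩),
    norm_mul, norm_mul, Complex.norm_real, Complex.norm_real,
    Real.norm_eq_abs, Real.abs_exp, Real.norm_eq_abs]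
  gcongr
  · rw [fst_eq_add_sq_mul_scatteringCoord hx.ne' y (𝒢.rescaledCurve x y p)]
    exact div_add_sq_mul_sub_div_le hF hx hX hxQ.2.le
  · exact hH _
  · exact hχM _ _

theorem tendsto_opAF (hn : 2 ≤ n) (hχ : IsCutoff K χ) (hF : 0 < F) (hy : y ∈ K)
    (hφ : Continuous φ) (hφs : HasCompactSupport φ) :
    Tendsto (fun x : ℝ => opAF 𝒢 χ F (scatteringPullback φ x y) (x, y)) (𝓝[>] 0)
      (𝓝 (∫ w, boundaryKernel 𝒢 χ F y w * φ w)) := by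
  obtain ⟨H, hH⟩ := hφ.bounded_above_of_compact_support hφs
  rw [(𝒢.integrable_boundaryKernel_mul_and_integral_eq hn hχ hF hy hφ hH).2]
  obtain ⟨R, T, B, hB⟩ := 𝒢.exists_norm_rescaledIntegrand_le hχ hF.le hy hφ hφs
  have hbox : Integrable ((Icc (-R) R ×ˢ (univ ×ˢ Icc (-T) T) : Set (RayParam n)).indicator
      fun _ => B) (rayVolume n) := by
    refine (integrable_indicator_iff
      (measurableSet_Icc.prod (MeasurableSet.univ.prod measurableSet_Icc))).2
        (integrableOn_const ?_)
    rw [Measure.prod_prod, Measure.prod_prod]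
    exact (ENNReal.mul_lt_top (by simp) (ENNReal.mul_lt_top (measure_lt_top _ _) (by simp))).ne
  have hmeas : ∀ᶠ x : ℝ in 𝓝[>] 0, AEStronglyMeasurable
      (𝒢.rescaledIntegrand χ F (scatteringPullback φ x y) x y) (rayVolume n) := by
    filter_upwards [𝒢.eventually_mem_U (𝒢.mem_U y hy)] with x hU
    exact 𝒢.aestronglyMeasurable_rescaledIntegrand hχ hy F (hφ.comp (by fun_prop)).measurable hU
  have hlim := tendsto_integral_filter_of_dominated_convergence _ hmeas
    (hB.mono fun x h => .of_forall h) hbox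
    (.of_forall fun p => 𝒢.tendsto_rescaledIntegrand (χ := χ) F (𝒢.mem_U y hy) hφ p)
  refine hlim.congr' ?_
  filter_upwards [self_mem_nhdsWithin, hmeas, hB] with x hx hm hb
  rw [𝒢.opAF_eq_integral_rescaledIntegrand χ F _ hx,
    integral_rayMeasure (hbox.mono' hm (.of_forall hb))]

theorem hasFrontFaceKernel_opAF (hn : 2 ≤ n) (hχ : IsCutoff K χ) (hF : 0 < F) (hy : y ∈ K) :
    HasFrontFaceKernel (opAF 𝒢 χ F) y (boundaryKernel 𝒢 χ F y) :=
  ⟨𝒢.integrable_boundaryKernel hn hχ hF hy,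
    fun _ hφ hφs => 𝒢.tendsto_opAF hn hχ hF hy hφ.continuous hφs⟩

end CurveFamily

/-! ### Ellipticity -/

theorem integral_comp_mul_prod {F : Type*} [NormedAddCommGroup F] [NormedSpace ℝ F]
    (g : ℝ × ℝ → F) {c d : ℝ} (hc : c ≠ 0) (hd : d ≠ 0) :
    ∫ q : ℝ × ℝ, g (c * q.1, d * q.2) = |(c * d)⁻¹| • ∫ q, g q := by
  have hmap : (volume : Measure (ℝ × ℝ)).map (Prod.map (c * ·) (d * ·)) =
      ENNReal.ofReal |(c * d)⁻¹| • volume := by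
    rw [Measure.volume_eq_prod, ← Measure.map_prod_map _ _ (by fun_prop) (by fun_prop),
      Real.map_volume_mul_left hc, Real.map_volume_mul_left hd, Measure.prod_smul_left,
      Measure.prod_smul_right, smul_smul, ← ENNReal.ofReal_mul (abs_nonneg _), ← abs_mul, mul_inv]
  have hemb : MeasurableEmbedding (Prod.map (c * ·) (d * ·) : ℝ × ℝ → ℝ × ℝ) :=
    (measurableEmbedding_mulLeft₀ hc).prodMap (measurableEmbedding_mulLeft₀ hd)
  have h := hemb.integral_map (μ := volume) g
  rw [hmap, integral_smul_measure, ENNReal.toReal_ofReal (abs_nonneg _)] at h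
  exact h.symm

/-- The reordering `(θ, (s, t)) ↦ (s, (θ, t))`. -/
def rayEquiv (α : Type*) [MeasurableSpace α] : α × (ℝ × ℝ) ≃ᵐ ℝ × (α × ℝ) :=
  MeasurableEquiv.prodAssoc.symm.trans
    ((MeasurableEquiv.prodComm.prodCongr (MeasurableEquiv.refl ℝ)).trans MeasurableEquiv.prodAssoc)

theorem measurePreserving_rayEquiv {α : Type*} [MeasurableSpace α] (ν : Measure α) [SFinite ν] :
    MeasurePreserving (rayEquiv α) (ν.prod volume) (rayMeasure ν) :=
  ((measurePreserving_prodAssoc _ _ _).comp (Measure.measurePreserving_swap.prod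
    (MeasurePreserving.id volume))).comp
    ((measurePreserving_prodAssoc _ (volume : Measure ℝ) (volume : Measure ℝ)).symm _)

theorem div_sqrt_div_sq_mem_Icc {C₁ C₂ a : ℝ} (hC₁ : 0 < C₁) (ha : a ∈ Icc C₁ C₂) (p : ℝ) {w : ℝ}
    (hw : 0 < w) : (p / √a / w) ^ 2 ∈ Icc (p ^ 2 / (C₂ * w ^ 2)) (p ^ 2 / (C₁ * w ^ 2)) := by
  obtain ⟨haC₁, haC₂⟩ := ha
  have ha0 : 0 < a := hC₁.trans_le haC₁
  rw [div_pow, div_pow, Real.sq_sqrt ha0.le, div_div]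
  constructor <;> gcongr

theorem sqrt_one_add_mul_sqrt_le {D p r : ℝ} (hD : 0 ≤ D) (hp : 0 ≤ p) (hr : 0 ≤ r) :
    √(1 + p) * √(1 + D * (r / (1 + p))) ≤ √(1 + D) * √(1 + p + r) := by
  rw [← Real.sqrt_mul (by positivity), ← Real.sqrt_mul (by positivity)]
  refine Real.sqrt_le_sqrt ?_
  have hprod : (1 + p) * (1 + D * (r / (1 + p))) = 1 + p + D * r := by field_simp
  rw [hprod]
  have : 0 ≤ D * (1 + p) + r := by positivity
  linear_combination this

section Sphere
variable {E : Type*} [NormedAddCommGroup E] [InnerProductSpace ℝ E]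

theorem exists_norm_eq_one_eq_norm_smul [Nontrivial E] (η : E) :
    ∃ e : E, ‖e‖ = 1 ∧ η = ‖η‖ • e := by
  rcases eq_or_ne η 0 with rfl | h
  · obtain ⟨e, he⟩ := exists_norm_eq E (zero_le_one (α := ℝ))
    exact ⟨e, he, by simp⟩
  · exact ⟨‖η‖⁻¹ • η, norm_smul_inv_norm h, (smul_inv_smul₀ (norm_ne_zero_iff.2 h) η).symm⟩

variable [MeasurableSpace E] [BorelSpace E] [FiniteDimensional ℝ E]

theorem integrable_toSphere_of_continuous {F : Type*} [NormedAddCommGroup F]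
    {f : UnitSphere E → F} (hf : Continuous f) : Integrable f (volume : Measure E).toSphere :=
  hf.integrable_of_hasCompactSupport (HasCompactSupport.of_compactSpace f)

theorem mul_sphereGaussian_sub_le_norm_integral {Φ : UnitSphere E → ℂ}
    (hΦ : Integrable Φ (volume : Measure E).toSphere) {u : UnitSphere E → ℝ} (hu : Continuous u)
    {e : E} {B₁ B₂ : ℝ} (hB₁ : ∀ θ : UnitSphere E, u θ ^ 2 / 2 ≤ B₁ * ⟪e, (θ : E)⟫ ^ 2)
    (hB₂ : ∀ θ : UnitSphere E, B₂ * ⟪e, (θ : E)⟫ ^ 2 ≤ u θ ^ 2 / 8) {M ε : ℝ} (hM : 0 ≤ M)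
    (hε : 0 ≤ ε) (h : ∀ θ, ‖Φ θ - (M * Real.exp (-(u θ) ^ 2 / 2) : ℝ)‖ ≤
      M * (ε * Real.exp (-(u θ) ^ 2 / 8))) :
    M * (sphereGaussian e B₁ - ε * sphereGaussian e B₂) ≤
      ‖∫ θ, Φ θ ∂(volume : Measure E).toSphere‖ := by
  set σ : Measure (UnitSphere E) := (volume : Measure E).toSphere
  let m (θ : UnitSphere E) : ℝ := M * Real.exp (-(u θ) ^ 2 / 2)
  have hm : Integrable m σ := integrable_toSphere_of_continuous (by fun_prop)
  have hlower : M * sphereGaussian e B₁ ≤ ‖((∫ θ, m θ ∂σ : ℝ) : ℂ)‖ := by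
    refine le_trans ?_ ((le_abs_self _).trans_eq (Complex.norm_real _).symm)
    rw [sphereGaussian, ← integral_const_mul]
    refine integral_mono (integrable_toSphere_of_continuous (by fun_prop)) hm fun θ =>
      mul_le_mul_of_nonneg_left (Real.exp_le_exp.2 ?_) hM
    linarith [hB₁ θ]
  have herror : ‖∫ θ, (Φ θ - (m θ : ℂ)) ∂σ‖ ≤ M * (ε * sphereGaussian e B₂) := by
    rw [sphereGaussian, ← integral_const_mul, ← integral_const_mul]
    refine norm_integral_le_of_norm_le (integrable_toSphere_of_continuous (by fun_prop))
      (.of_forall fun θ => (h θ).trans ?_)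
    gcongr
    linarith [hB₂ θ]
  have hsub : ((∫ θ, m θ ∂σ : ℝ) : ℂ) = ∫ θ, Φ θ ∂σ - ∫ θ, (Φ θ - (m θ : ℂ)) ∂σ := by
    have hmc : Integrable (fun θ => (m θ : ℂ)) σ := hm.ofReal
    rw [integral_sub hΦ hmc, integral_complex_ofReal, sub_sub_cancel]
  have htriangle := norm_sub_le (∫ θ, Φ θ ∂σ) (∫ θ, (Φ θ - (m θ : ℂ)) ∂σ)
  rw [← hsub] at htriangle
  linarith

theorem exists_le_sphereGaussian_sub_mul (hE : 2 ≤ Module.finrank ℝ E) {D : ℝ} (hD : 0 ≤ D) :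
    ∃ ε c : ℝ, 0 < ε ∧ 0 < c ∧ ∀ (e : E) (B : ℝ), ‖e‖ = 1 → 0 ≤ B →
      c / √(1 + D * B) ≤ sphereGaussian e (D * B) - ε * sphereGaussian e B := by
  have : Nontrivial E := Module.nontrivial_of_finrank_pos (R := ℝ) (by omega)
  obtain ⟨A, hA, hupper⟩ := exists_sphereGaussian_le (E := E)
  obtain ⟨c, hc, hlower⟩ := exists_le_sphereGaussian hE
  refine ⟨c / (2 * A * √(1 + D)), c / 2, by positivity, by positivity, fun e B he hB => ?_⟩
  have hsqrt : √(1 + D * B) ≤ √(1 + D) * √(1 + B) := by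
    rw [← Real.sqrt_mul (by positivity)]
    exact Real.sqrt_le_sqrt (by linarith)
  have herror : c / (2 * A * √(1 + D)) * sphereGaussian e B ≤ c / 2 / √(1 + D * B) := by
    calc _ ≤ c / (2 * A * √(1 + D)) * (A / √(1 + B)) := by gcongr; exact hupper e B he hB
      _ = c / 2 / (√(1 + D) * √(1 + B)) := by field_simp
      _ ≤ _ := by gcongr
  have hhalves : c / √(1 + D * B) = c / 2 / √(1 + D * B) + c / 2 / √(1 + D * B) := by ring
  linarith [hlower e (D * B) he (by positivity)]

theorem exists_le_norm_integral_modelSymbol (hE : 2 ≤ Module.finrank ℝ E) {C₁ C₂ : ℝ}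
    (hC₁ : 0 < C₁) (hC₂ : 0 < C₂) :
    ∃ ψ : ℝ → ℝ, ContDiff ℝ ∞ ψ ∧ (∃ R, ∀ s, R < |s| → ψ s = 0) ∧ (∀ s, 0 ≤ ψ s) ∧ ψ 0 = 1 ∧
      ∃ c : ℝ, 0 < c ∧ ∀ a : UnitSphere E → ℝ, Continuous a → (∀ θ, a θ ∈ Icc C₁ C₂) →
        ∀ (ξ : ℝ) (η : E),
          Integrable (fun θ : UnitSphere E => modelSymbol ψ ξ (⟪η, (θ : E)⟫ / √(a θ)))
            (volume : Measure E).toSphere →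
          c / √(1 + ξ ^ 2 + ‖η‖ ^ 2) ≤ ‖∫ θ : UnitSphere E,
            modelSymbol ψ ξ (⟪η, (θ : E)⟫ / √(a θ)) ∂(volume : Measure E).toSphere‖ := by
  have : Nontrivial E := Module.nontrivial_of_finrank_pos (R := ℝ) (by omega)
  obtain ⟨ε, c, hε, hc, hgauss⟩ :=
    exists_le_sphereGaussian_sub_mul hE (D := 4 * C₂ / C₁) (by positivity)
  obtain ⟨ψ, hψ, hR, hψ0, hψ1, happrox⟩ := exists_modelSymbol_approx hε
  refine ⟨ψ, hψ, hR, hψ0, hψ1, 2 * Real.pi * c / √(1 + 1 / (2 * C₁)), by positivity,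
    fun a ha haC ξ η hint => ?_⟩
  obtain ⟨e, he, hη⟩ := exists_norm_eq_one_eq_norm_smul η
  set w := √(1 + ξ ^ 2)
  have hw : 0 < w := by positivity
  have hw2 : w ^ 2 = 1 + ξ ^ 2 := Real.sq_sqrt (by positivity)
  let u (θ : UnitSphere E) : ℝ := ⟪η, (θ : E)⟫ / √(a θ) / w
  have hu : Continuous u := ((continuous_const.inner continuous_subtype_val).div
    (Real.continuous_sqrt.comp ha)
      fun θ => (Real.sqrt_pos.2 (hC₁.trans_le (haC θ).1)).ne').div_const w
  have hinner (θ : UnitSphere E) : ⟪η, (θ : E)⟫ ^ 2 = ‖η‖ ^ 2 * ⟪e, (θ : E)⟫ ^ 2 := by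
    rw [← mul_pow, ← real_inner_smul_left, ← hη]
  set B := ‖η‖ ^ 2 / (8 * C₂ * w ^ 2) with hB
  have hDB : 4 * C₂ / C₁ * B = 1 / (2 * C₁) * (‖η‖ ^ 2 / (1 + ξ ^ 2)) := by
    rw [hB, hw2]
    field_simp
    ring
  have hupper (θ : UnitSphere E) : u θ ^ 2 / 2 ≤ 4 * C₂ / C₁ * B * ⟪e, (θ : E)⟫ ^ 2 := by
    calc _ ≤ ⟪η, (θ : E)⟫ ^ 2 / (C₁ * w ^ 2) / 2 := by
          gcongr
          exact (div_sqrt_div_sq_mem_Icc hC₁ (haC θ) _ hw).2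
      _ = _ := by rw [hinner, hDB, hw2]; field_simp
  have hlower (θ : UnitSphere E) : B * ⟪e, (θ : E)⟫ ^ 2 ≤ u θ ^ 2 / 8 := by
    calc _ = ⟪η, (θ : E)⟫ ^ 2 / (C₂ * w ^ 2) / 8 := by rw [hinner, hB]; field_simp
      _ ≤ _ := by gcongr; exact (div_sqrt_div_sq_mem_Icc hC₁ (haC θ) _ hw).1
  have hbracket :
      w * √(1 + 4 * C₂ / C₁ * B) ≤ √(1 + 1 / (2 * C₁)) * √(1 + ξ ^ 2 + ‖η‖ ^ 2) := by
    rw [hDB]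
    exact sqrt_one_add_mul_sqrt_le (by positivity) (sq_nonneg ξ) (sq_nonneg _)
  calc _ = 2 * Real.pi * c / (√(1 + 1 / (2 * C₁)) * √(1 + ξ ^ 2 + ‖η‖ ^ 2)) := div_div _ _ _
    _ ≤ 2 * Real.pi * c / (w * √(1 + 4 * C₂ / C₁ * B)) :=
        div_le_div_of_nonneg_left (by positivity) (by positivity) hbracket
    _ = 2 * Real.pi / w * (c / √(1 + 4 * C₂ / C₁ * B)) := by field_simp
    _ ≤ _ := by gcongr; exact hgauss e B he (by positivity)
    _ ≤ _ := mul_sphereGaussian_sub_le_norm_integral hint hu hupper hlower (by positivity) hε.le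
      fun θ => happrox _ _

end Sphere

/-- The plane wave `exp (-i (ξ X + η · Y))`. -/
def planeWave {n : ℕ} (ξ : ℝ) (η : Tang n) (w : ℝ × Tang n) : ℂ :=
  Complex.exp (-Complex.I * ((ξ * w.1 + inner ℝ η w.2 : ℝ) : ℂ))

theorem continuous_planeWave {n : ℕ} (ξ : ℝ) (η : Tang n) : Continuous (planeWave ξ η) := by
  unfold planeWave
  fun_prop

theorem norm_planeWave {n : ℕ} (ξ : ℝ) (η : Tang n) (w : ℝ × Tang n) : ‖planeWave ξ η w‖ = 1 := by
  rw [planeWave, Complex.norm_exp]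
  simp

namespace CurveFamily

variable {n : ℕ} {K : Set (Tang n)} (𝒢 : CurveFamily n K)

/-- The cutoff with profile `ψ` in the variable `s √(F / α)`. With this scaling, `s` and `t` can be
rescaled in the kernel so that `F` and `α` disappear from its exponential factor. -/
def scaledCutoff (ψ : ℝ → ℝ) (F : ℝ) (s : ℝ) (y θ : Tang n) : ℝ := ψ (s * √(F / 𝒢.α 0 y 0 θ 0))

theorem exists_isOpen_frontAccel_mem_Icc (hK : IsCompact K) :
    ∃ (V : Set (Tang n)) (C₁ C₂ : ℝ), IsOpen V ∧ K ⊆ V ∧ 0 < C₁ ∧ 0 < C₂ ∧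
      (∀ y ∈ V, ((0 : ℝ), y) ∈ 𝒢.U) ∧ ∀ y ∈ V, ∀ θ, 𝒢.frontAccel y θ ∈ Icc C₁ C₂ := by
  obtain ⟨C, hC, hCα⟩ := 𝒢.convex
  have hO : IsOpen {y : Tang n | ((0 : ℝ), y) ∈ 𝒢.U} :=
    𝒢.isOpen_U.preimage (by fun_prop : Continuous fun y : Tang n => ((0 : ℝ), y))
  obtain ⟨L, hL, hKL, hLU⟩ := exists_compact_between hK hO fun y hy => 𝒢.mem_U y hy
  have hα : ContinuousOn (fun p : Tang n × UnitSphere (Tang n) => 𝒢.frontAccel p.1 p.2)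
      (L ×ˢ univ) :=
    𝒢.smooth_α.continuousOn.comp
      (f := fun p : Tang n × UnitSphere (Tang n) =>
        ((0 : ℝ), p.1, (0 : ℝ), (p.2 : Tang n), (0 : ℝ)))
      (by fun_prop) fun p hp => 𝒢.mem_paramDomain_zero (hLU hp.1) p.2
  obtain ⟨M, hM⟩ := (hL.prod isCompact_univ).exists_bound_of_continuousOn hα
  refine ⟨interior L, C, max M 1, isOpen_interior, hKL, hC, lt_max_of_lt_right one_pos,
    fun y hy => hLU (interior_subset hy), fun y hy θ => ⟨?_, ?_⟩⟩
  · exact hCα _ _ _ _ _ (𝒢.mem_paramDomain_zero (hLU (interior_subset hy)) θ)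
  · exact (le_abs_self _).trans
      ((hM (y, θ) ⟨interior_subset hy, mem_univ _⟩).trans (le_max_left _ _))

variable {F : ℝ} {ψ : ℝ → ℝ} {R : ℝ}

theorem isCutoff_scaledCutoff (hK : IsCompact K) (hF : 0 < F) (hψ : ContDiff ℝ ∞ ψ)
    (hR : ∀ s, R < |s| → ψ s = 0) : IsCutoff K (𝒢.scaledCutoff ψ F) := by
  obtain ⟨V, C₁, C₂, hV, hKV, hC₁, hC₂, hVU, hα⟩ := 𝒢.exists_isOpen_frontAccel_mem_Icc hK
  refine ⟨V, hV, hKV, ?_, max R 0 / √(F / C₂), fun s y hy θ hθ hs => ?_⟩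
  · have hsmooth : ContDiffOn ℝ ∞ (fun p : ℝ × Tang n × Tang n => 𝒢.α 0 p.2.1 0 p.2.2 0)
        (univ ×ˢ V ×ˢ Metric.sphere (0 : Tang n) 1) :=
      𝒢.smooth_α.comp (f := fun p : ℝ × Tang n × Tang n =>
        ((0 : ℝ), p.2.1, (0 : ℝ), p.2.2, (0 : ℝ))) (by fun_prop)
        fun p hp => 𝒢.mem_paramDomain_zero (hVU _ hp.2.1) ⟨p.2.2, hp.2.2⟩
    have hpos : ∀ p ∈ (univ ×ˢ V ×ˢ Metric.sphere (0 : Tang n) 1 : Set (ℝ × Tang n × Tang n)),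
        0 < 𝒢.α 0 p.2.1 0 p.2.2 0 := fun p hp =>
      hC₁.trans_le (hα p.2.1 hp.2.1 ⟨p.2.2, hp.2.2⟩).1
    exact hψ.comp_contDiffOn (contDiff_fst.contDiffOn.mul
      ((contDiffOn_const.div hsmooth fun p hp => (hpos p hp).ne').sqrt
        fun p hp => (div_pos hF (hpos p hp)).ne'))
  · obtain ⟨hαC₁, hαC₂⟩ := hα y hy ⟨θ, hθ⟩
    simp only [frontAccel] at hαC₁ hαC₂
    have hα0 : 0 < 𝒢.α 0 y 0 θ 0 := hC₁.trans_le hαC₁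
    refine hR _ ((le_max_left R 0).trans_lt ?_)
    rw [div_lt_iff₀ (by positivity)] at hs
    refine hs.trans_le ?_
    rw [abs_mul, abs_of_nonneg (Real.sqrt_nonneg _)]
    gcongr

theorem integral_pulledKernel_scaledCutoff (ψ : ℝ → ℝ) (hF : 0 < F) {y : Tang n}
    {θ : UnitSphere (Tang n)} (ha : 0 < 𝒢.frontAccel y θ) (ξ : ℝ) (η : Tang n) :
    ∫ q : ℝ × ℝ, 𝒢.pulledKernel (𝒢.scaledCutoff ψ F) F y (planeWave ξ η) (q.1, θ, q.2) =
      (F⁻¹ : ℝ) * modelSymbol ψ (ξ / F) (⟪η, (θ : Tang n)⟫ / √(𝒢.frontAccel y θ * F)) := by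
  set a := 𝒢.frontAccel y θ with ha_def
  set c := √(F / a) with hc
  set d := √(a * F) with hd
  have hcd : c * d = F := by
    rw [hc, hd, ← Real.sqrt_mul (by positivity), div_mul_eq_mul_div, mul_left_comm,
      mul_div_cancel_left₀ _ ha.ne', Real.sqrt_mul_self hF.le]
  have hd2 : d ^ 2 = a * F := Real.sq_sqrt (by positivity)
  have hc0 : c ≠ 0 := left_ne_zero_of_mul (hcd.trans_ne hF.ne')
  have hd0 : d ≠ 0 := right_ne_zero_of_mul (hcd.trans_ne hF.ne')
  have hscale := integral_comp_mul_prod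
    (fun x : ℝ × ℝ => Complex.exp (modelPhase (ξ / F) (⟪η, (θ : Tang n)⟫ / d) x) * ψ x.1) hc0 hd0
  rw [hcd, abs_of_pos (inv_pos.2 hF), Complex.real_smul] at hscale
  rw [modelSymbol, ← hscale]
  congr 1 with ⟨s, t⟩
  simp only [pulledKernel, parabolicPolar, scaledCutoff, planeWave, modelPhase, inner_smul_right,
    ← ha_def]
  rw [show F / 𝒢.α 0 y 0 θ 0 = F / a from rfl, ← hc, Complex.ofReal_mul, Complex.ofReal_exp,
    mul_right_comm, ← Complex.exp_add, mul_comm s c]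
  congr 2
  have hform : ((c * s : ℝ) : ℂ) * ((d * t : ℝ) : ℂ) + ((d * t : ℝ) : ℂ) ^ 2 =
      F * (s * t + a * t ^ 2) := by
    norm_cast
    linear_combination s * t * hcd + t ^ 2 * hd2
  have hFc : (F : ℂ) ≠ 0 := by exact_mod_cast hF.ne'
  have hdc : (d : ℂ) ≠ 0 := by exact_mod_cast hd0
  rw [hform]
  push_cast
  field_simp
  ring

theorem fourierXY_boundaryKernel_scaledCutoff (hn : 2 ≤ n) (hK : IsCompact K) (hF : 0 < F)
    (hψ : ContDiff ℝ ∞ ψ) (hR : ∀ s, R < |s| → ψ s = 0) {y : Tang n} (hy : y ∈ K) (ξ : ℝ)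
    (η : Tang n) :
    Integrable (fun θ : UnitSphere (Tang n) =>
      modelSymbol ψ (ξ / F) (⟪η, (θ : Tang n)⟫ / √(𝒢.frontAccel y θ * F)))
      (volume : Measure (Tang n)).toSphere ∧
    fourierXY (boundaryKernel 𝒢 (𝒢.scaledCutoff ψ F) F y) ξ η =
      (F⁻¹ : ℝ) * ∫ θ : UnitSphere (Tang n),
        modelSymbol ψ (ξ / F) (⟪η, (θ : Tang n)⟫ / √(𝒢.frontAccel y θ * F))
        ∂(volume : Measure (Tang n)).toSphere := by
  set σ := (volume : Measure (Tang n)).toSphere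
  obtain ⟨C, hC, hCa⟩ := 𝒢.exists_le_frontAccel
  have hχ := 𝒢.isCutoff_scaledCutoff hK hF hψ hR
  have hwave (w : ℝ × Tang n) : ‖planeWave ξ η w‖ ≤ 1 := (norm_planeWave ξ η w).le
  have hslice (θ : UnitSphere (Tang n)) :=
    𝒢.integral_pulledKernel_scaledCutoff ψ hF (hC.trans_le (hCa y hy θ)) ξ η
  have hemb := (rayEquiv (UnitSphere (Tang n))).measurableEmbedding
  have hint := ((measurePreserving_rayEquiv σ).integrable_comp_emb hemb).2
    (𝒢.integrable_pulledKernel hχ hF hy (continuous_planeWave ξ η) hwave)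
  constructor
  · have hFc : ((F⁻¹ : ℝ) : ℂ) ≠ 0 := by exact_mod_cast (inv_pos.2 hF).ne'
    refine (integrable_const_mul_iff hFc.isUnit _).1 (hint.integral_prod_left.congr ?_)
    exact .of_forall hslice
  · calc fourierXY (boundaryKernel 𝒢 (𝒢.scaledCutoff ψ F) F y) ξ η
        = ∫ w, boundaryKernel 𝒢 (𝒢.scaledCutoff ψ F) F y w * planeWave ξ η w :=
          integral_congr_ae (.of_forall fun w => mul_comm _ _)
      _ = ∫ p, 𝒢.pulledKernel (𝒢.scaledCutoff ψ F) F y (planeWave ξ η) p ∂(rayVolume n) :=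
          (𝒢.integrable_boundaryKernel_mul_and_integral_eq hn hχ hF hy
            (continuous_planeWave ξ η) hwave).2
      _ = _ := by
          rw [← (measurePreserving_rayEquiv σ).integral_comp hemb, ← integral_const_mul]
          exact (integral_prod _ hint).trans (integral_congr_ae (.of_forall hslice))

theorem exists_elliptic_cutoff (hn : 3 ≤ n) (hK : IsCompact K) (hF : 0 < F) :
    ∃ χ : ℝ → Tang n → Tang n → ℝ, IsCutoff K χ ∧ (∀ s y θ, 0 ≤ χ s y θ) ∧ (∀ y θ, χ 0 y θ = 1) ∧
      ∃ c : ℝ, 0 < c ∧ ∀ y ∈ K, ∀ (ξ : ℝ) (η : Tang n),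
        c * (japanese ξ η)⁻¹ ≤ ‖fourierXY (boundaryKernel 𝒢 χ F y) ξ η‖ := by
  have hdim : 2 ≤ Module.finrank ℝ (Tang n) := by
    rw [finrank_euclideanSpace_fin]
    omega
  obtain ⟨V, C₁, C₂, -, hKV, hC₁, hC₂, -, ha⟩ := 𝒢.exists_isOpen_frontAccel_mem_Icc hK
  obtain ⟨ψ, hψ, ⟨R, hR⟩, hψ0, hψ1, c, hc, hcle⟩ :=
    exists_le_norm_integral_modelSymbol hdim (mul_pos hC₁ hF) (mul_pos hC₂ hF)
  refine ⟨𝒢.scaledCutoff ψ F, 𝒢.isCutoff_scaledCutoff hK hF hψ hR, fun s y θ => hψ0 _,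
    fun y θ => by simp [scaledCutoff, hψ1], F⁻¹ * (c / √(1 + 1 / F ^ 2)), by positivity,
    fun y hy ξ η => ?_⟩
  obtain ⟨hint, hsymbol⟩ :=
    𝒢.fourierXY_boundaryKernel_scaledCutoff (by omega) hK hF hψ hR hy ξ η
  rw [hsymbol, norm_mul, Complex.norm_real, Real.norm_of_nonneg (inv_pos.2 hF).le, mul_assoc]
  gcongr
  have hbracket : √(1 + (ξ / F) ^ 2 + ‖η‖ ^ 2) ≤ √(1 + 1 / F ^ 2) * japanese ξ η := by
    rw [japanese, ← Real.sqrt_mul (by positivity)]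
    refine Real.sqrt_le_sqrt ?_
    have : 0 ≤ ξ ^ 2 + 1 / F ^ 2 * (1 + ‖η‖ ^ 2) := by positivity
    linear_combination this
  have hmem (θ : UnitSphere (Tang n)) : 𝒢.frontAccel y θ * F ∈ Icc (C₁ * F) (C₂ * F) := by
    obtain ⟨hlower, hupper⟩ := ha y (hKV hy) θ
    constructor <;> gcongr
  calc c / √(1 + 1 / F ^ 2) * (japanese ξ η)⁻¹ = c / (√(1 + 1 / F ^ 2) * japanese ξ η) := by
        rw [← div_eq_mul_inv, div_div]
    _ ≤ c / √(1 + (ξ / F) ^ 2 + ‖η‖ ^ 2) := by gcongr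
    _ ≤ _ := hcle _ ((𝒢.continuous_frontAccel (𝒢.mem_U y hy)).mul_const F) hmem _ _ hint

end CurveFamily

end LocalXray

end

theorem proposition2p3 (n : ℕ) (hn : 3 ≤ n) (K : Set (LocalXray.Tang n)) (hK : IsCompact K)
    (𝒢 : LocalXray.CurveFamily n K) (F : ℝ) (hF : 0 < F) :
    (∀ χ : ℝ → LocalXray.Tang n → LocalXray.Tang n → ℝ, LocalXray.IsCutoff K χ → ∀ y ∈ K,
      LocalXray.HasFrontFaceKernel (LocalXray.opAF 𝒢 χ F) y (LocalXray.boundaryKernel 𝒢 χ F y) ∧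
      LocalXray.HasBoundarySymbol (LocalXray.opAF 𝒢 χ F) y
        (LocalXray.fourierXY (LocalXray.boundaryKernel 𝒢 χ F y))) ∧
    ∃ χ : ℝ → LocalXray.Tang n → LocalXray.Tang n → ℝ,
      LocalXray.IsCutoff K χ ∧ (∀ s y θ, 0 ≤ χ s y θ) ∧ (∀ y θ, χ 0 y θ = 1) ∧
      LocalXray.IsBoundaryElliptic K (LocalXray.opAF 𝒢 χ F) := by
  refine ⟨fun χ hχ y hy => ⟨𝒢.hasFrontFaceKernel_opAF (by omega) hχ hF hy,
    _, 𝒢.hasFrontFaceKernel_opAF (by omega) hχ hF hy, rfl⟩, ?_⟩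
  obtain ⟨χ, hχ, h0, h1, c, hc, hcle⟩ := 𝒢.exists_elliptic_cutoff hn hK hF
  exact ⟨χ, hχ, h0, h1, fun y => LocalXray.fourierXY (LocalXray.boundaryKernel 𝒢 χ F y),
    fun y hy => ⟨_, 𝒢.hasFrontFaceKernel_opAF (by omega) hχ hF hy, rfl⟩, c, hc, hcle⟩
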